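/- **Setting.** Let $\mathbb F$ be a field. A $\Sigma^{k}\Pi\Sigma$ circuit over $\mathbb F[x_1,\dots,x_n]$ is a formal sum $C=\sum_{i=1}^{m}M_i$ of $1\le m\le k$ multiplication gates $M_i=c_i\prod_{j=1}^{d_i}\ell_{i,j}$, with $c_i\in\mathbb F$ and $\ell_{i,j}$ non-constant affine linear functions; $[C]$ denotes the polynomial it computes. $C$ is *multilinear* if every gate computes a multilinear polynomial, and *minimal* if $\sum_{i\in S}[M_i]\ne0$ for every $\emptyset\neq S\subsetneq[m]$. Let $\gcd(C)$ be the multiset of linear functions (up to constant multiples) appearing in all gates of $C$; $C$ is *simple* if $\gcd(C)=1$. The syntactic rank $\Delta_{\mathrm{syn}}(C)$ is the dimension of the span of all linear functions appearing in the $M_i/\gcd(C)$, and $\mathrm{dist}(C,C')=\Delta_{\mathrm{syn}}(C+C')$, where $C+C'$ is the formal sum of all gates of both circuits. Let $R_M(k)$ be the largest syntactic rank of a simple minimal multilinear circuit with at most $k$ gates, over any field and in any number of variables, computing the zero polynomial (this is finite). For a partition $\{A_1,\dots,A_s\}$ of the gates of $C$ into non-empty sets, with clusters $C_i=\sum_{j\in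 A_i}M_j$, say that it is a $(\tau,r)$-*syntactic partition* if $\Delta_{\mathrm{syn}}(C_i)\le r$ for all $i$ and $\mathrm{dist}(C_i,C_j)\ge\tau r$ for all $i\ne j$. For a circuit with at most $k$ gates, a *$\tau$-clustering* of $C$ is a partition that is, for some integer $r\ge R_M(2k)$, a $(\tau,r)$-syntactic partition such that either $r$ is the lowest value $\ge R_M(2k)$ for which $C$ has a $(\tau,r)$-syntactic partition, or $r\le (k\tau)^{\max(k-2,0)}R_M(2k)$. (These are the guarantees of the syntactic clustering algorithm; a $\tau$-clustering with the lowest $r$ always exists.) **Theorem.** There is an absolute constant $c$ such that for every field $\mathbb F$, all $n$ and $k\geq 1$, and every polynomial $f\in\mathbb F[x_1,\dots,x_n]$ computed by a multilinear $\Sigma^{k}\Pi\Sigma$ circuit, there is $\tau\in\mathbb N$ with $\tau\le (c\,k^{k+2})^{k^{2k+1}}$ such that the following holds. Let $C,D$ be any two minimal multilinear $\Sigma^{k}\Pi\Sigma$ circuits computing $f$, and let $C=\sum_{i=1}^{s}C_i$ and $D=\sum_{i=1}^{s'}D_i$ be $\tau$-clusterings of $C$ and $D$. Then $s=s'$, and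 there is a permutation $\pi$ of $[s]$ such that for every $i\in[s]$, $[C_i]=[D_{\pi(i)}]$ and $$\frac{\Delta_{\mathrm{syn}}(C_i)}{k}-2R_M(2k)\;\le\;\Delta_{\mathrm{syn}}(D_{\pi(i)})\;\le\;k\,\Delta_{\mathrm{syn}}(C_i)+2k\,R_M(2k).$$ -/

import Mathlib

universe u

namespace DepthThree

/-- A multiplication gate `c · ∏ ℓ`: a scalar times a product of (affine, non-constant) linear
functions in the variables `x_0, …, x_{n-1}`. Constant factors are collected in `coeff`. -/
structure MulGate (F : Type u) [Field F] (n : ℕ) where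
  coeff : F
  factors : Multiset (MvPolynomial (Fin n) F)
  linear : ∀ ℓ ∈ factors, ℓ.totalDegree = 1

/-- The polynomial computed by a multiplication gate. -/
noncomputable def MulGate.poly {F : Type u} [Field F] {n : ℕ} (M : MulGate F n) :
    MvPolynomial (Fin n) F :=
  MvPolynomial.C M.coeff * M.factors.prod

/-- The linear functions of a gate up to multiplication by a non-zero constant
(the units of the polynomial ring), with multiplicity. -/
noncomputable def MulGate.classes {F : Type u} [Field F] {n : ℕ} (M : MulGate F n) :
    Multiset (Associates (MvPolynomial (Fin n) F)) :=
  M.factors.map Associates.mk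

/-- A depth-3 (`ΣΠΣ`) circuit whose multiplication gates are indexed by `ι`;
its top fan-in is the cardinality of `ι`. -/
abbrev Circuit (F : Type u) [Field F] (n : ℕ) (ι : Type) := ι → MulGate F n

namespace Circuit

variable {F : Type u} [Field F] {n : ℕ} {ι κ : Type}

/-- `[C]`, the polynomial computed by the circuit `C`. -/
noncomputable def poly [Fintype ι] (C : Circuit F n ι) : MvPolynomial (Fin n) F :=
  ∑ i, (C i).poly

/-- The subcircuit consisting of the multiplication gates in `A`. -/
def sub (C : Circuit F n ι) (A : Finset ι) : Circuit F n A := fun i => C i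

/-- The syntactic sum `C + C'`: sum all multiplication gates of `C` and of `C'`. -/
def add (C : Circuit F n ι) (C' : Circuit F n κ) : Circuit F n (ι ⊕ κ) := Sum.elim C C'

/-- Every multiplication gate computes a multilinear polynomial (and hence so does the top gate). -/
def IsMultilinear (C : Circuit F n ι) : Prop :=
  ∀ i, (C i).poly ∈ MvPolynomial.restrictDegree (Fin n) F 1

/-- No non-empty proper subset of the multiplication gates sums to zero. -/
def IsMinimal [Fintype ι] (C : Circuit F n ι) : Prop :=
  ∀ S : Finset ι, S.Nonempty → S ≠ Finset.univ → ∑ i ∈ S, (C i).poly ≠ 0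

open scoped Classical in
/-- `gcd(C)`: the linear functions (up to constants, with multiplicity) that appear in all
multiplication gates of `C`. -/
noncomputable def gcd [Fintype ι] (C : Circuit F n ι) :
    Multiset (Associates (MvPolynomial (Fin n) F)) :=
  if h : (Finset.univ : Finset ι).Nonempty then Finset.univ.inf' h (fun i => (C i).classes) else 0

/-- `C` is simple if `gcd(C) = 1`. -/
def IsSimple [Fintype ι] (C : Circuit F n ι) : Prop := C.gcd = 0

open scoped Classical in
/-- The linear functions (all scalings of them) appearing in `M_i / gcd(C)`. -/
def residual [Fintype ι] (C : Circuit F n ι) (i : ι) : Set (MvPolynomial (Fin n) F) :=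
  {ℓ | Associates.mk ℓ ∈ (C i).classes - C.gcd}

/-- The syntactic rank `Δ_syn(C)`: the dimension of the span of the linear functions that appear
in the simplification `C / gcd(C)`. -/
noncomputable def synRank [Fintype ι] (C : Circuit F n ι) : ℕ :=
  Module.finrank F (Submodule.span F (⋃ i, C.residual i))

/-- `dist(C, C') = Δ_syn(C + C')`. -/
noncomputable def dist [Fintype ι] [Fintype κ] (C : Circuit F n ι) (C' : Circuit F n κ) : ℕ :=
  (C.add C').synRank

/-- The partition `P` of the multiplication gates of `C` is a `(τ, r)`-syntactic partition:
each cluster has syntactic rank at most `r`, and distinct clusters have distance at least `τ r`. -/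
def IsSynPartition [Fintype ι] [DecidableEq ι] (C : Circuit F n ι)
    (P : Finpartition (Finset.univ : Finset ι)) (τ r : ℕ) : Prop :=
  (∀ A ∈ P.parts, (C.sub A).synRank ≤ r) ∧
  ∀ A ∈ P.parts, ∀ B ∈ P.parts, A ≠ B → τ * r ≤ (C.sub A).dist (C.sub B)

end Circuit

/-- `R_M(k)`: the largest syntactic rank of a simple and minimal multilinear circuit of top fan-in
at most `k` that computes the zero polynomial, over all fields and all numbers of variables. -/
noncomputable def rankBoundML (k : ℕ) : ℕ :=
  sSup {r : ℕ | ∃ (F : Type u) (_ : Field F) (n m : ℕ) (C : Circuit F n (Fin m)),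
    m ≤ k ∧ C.IsMultilinear ∧ C.IsSimple ∧ C.IsMinimal ∧ C.poly = 0 ∧ C.synRank = r}

/-- `f` is computed by a multilinear `Σ^k Π Σ` circuit
(a multilinear circuit with at least one and at most `k` multiplication gates). -/
def MemSPS {F : Type u} [Field F] {n : ℕ} (k : ℕ) (f : MvPolynomial (Fin n) F) : Prop :=
  ∃ (m : ℕ) (C : Circuit F n (Fin m)), 1 ≤ m ∧ m ≤ k ∧ C.IsMultilinear ∧ C.poly = f

/-- The guarantee of the syntactic clustering algorithm with parameter `τ` on a circuit `C` of top
fan-in at most `k`. The algorithm outputs `r ≥ R_M(2k)` and a `(τ, r)`-syntactic partition of `C`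
such that `r ≤ (kτ)^(k-2) R_M(2k)`; in its exhaustive version, `r` is the lowest value among all
`(τ, r')`-syntactic partitions with `r' ≥ R_M(2k)`. A partition that meets either of the two
guarantees on `r` is admitted; one with the lowest `r` always exists. -/
def IsClusteringOutput {F : Type u} [Field F] {n : ℕ} {ι : Type} [Fintype ι] [DecidableEq ι]
    (k τ : ℕ) (C : Circuit F n ι) (P : Finpartition (Finset.univ : Finset ι)) : Prop :=
  ∃ r : ℕ, rankBoundML.{u} (2 * k) ≤ r ∧ C.IsSynPartition P τ r ∧
    (r ≤ (k * τ) ^ (k - 2) * rankBoundML.{u} (2 * k) ∨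
      ∀ (P' : Finpartition (Finset.univ : Finset ι)) (r' : ℕ),
        rankBoundML.{u} (2 * k) ≤ r' → C.IsSynPartition P' τ r' → r ≤ r')

end DepthThree

/-! Write R = R_M(2k). Let C and D be minimal circuits for f ≠ 0. The gates of C and of -D sum to
zero, so they split into minimal vanishing sums ("pieces"). A piece has at most 2k gates, hence
syntactic rank at most R, and by minimality it contains gates of both circuits
(`exists_common_pieces`). Rank is subadditive on sets of gates that share a gate
(`gateRank_union_le`). So if the clusters of C have rank at most r, those of D rank at most r', and
the latter have distances above 2r' + 2R + r, then the pieces meeting one cluster of C reach only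
one cluster of D. This gives a surjection from the clusters of C onto those of D. If the numbers of
clusters agree it is a bijection and no piece crosses it, so matched clusters compute the same
polynomial and their ranks differ by at most kR (`card_le_and_clusterMatch`).

Choice of τ: a τ-clustering has r ≤ (kτ)^(k-1) R. If τ_{j+1} ≥ (kτ_j)^(k-1) + 5, then a
τ_{j+1}-clustering of any minimal circuit for f has at most as many clusters as a τ_j-clustering of
any other. The counts lie between 1 and k, so for one of the first k candidates they all coincide.
The strict inequalities use R ≥ 1.

All this needs R_M to be finite, which rests on `exists_card_sub_bound`. The linear factors of a
multilinear gate use disjoint variables, so they are independent; each reduction modulo a linear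
form costs one unit of defect. Induct on the number of gates. If one gate has many factors ℓ missing
from another, then modulo each ℓ a shorter minimal vanishing subsum survives, whose members are
close to each other by induction. Many ℓ give the same subsum. Closeness modulo many independent ℓ
forces closeness outright (`card_le_of_matchedAlong`), so the subsum is a large common factor times
a cofactor of bounded degree. But it is non-zero and divisible by all these ℓ, none of which divides
a summand (`card_le_of_dvd_sum`). -/

namespace DepthThree

open UniqueFactorizationMonoid

/-! ### Nearly independent families and matchings along directions -/

section NearIndependence

variable {F V : Type*} [Field F] [AddCommGroup V] [Module F V]

open scoped Classical in
/-- A multiset of vectors is independent up to defect `t` if every finite-dimensional subspace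
`W` contains at most `dim W + t` of its members. -/
def NearIndep (F : Type*) {V : Type*} [Field F] [AddCommGroup V] [Module F V]
    (t : ℕ) (S : Multiset V) : Prop :=
  ∀ W : Submodule F V, FiniteDimensional F W →
    (S.filter (· ∈ W)).card ≤ Module.finrank F W + t

lemma NearIndep.mono {t : ℕ} {S T : Multiset V} (h : NearIndep F t T) (hST : S ≤ T) :
    NearIndep F t S := by
  classical
  intro W hW
  refine le_trans (Multiset.card_le_card ?_) (h W hW)
  exact Multiset.filter_le_filter _ hST

lemma NearIndep.card_le {t : ℕ} {S T : Multiset V} (h : NearIndep F t T) (hST : S ≤ T)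
    (W : Submodule F V) (hW : FiniteDimensional F W) (hS : ∀ x ∈ S, x ∈ W) :
    S.card ≤ Module.finrank F W + t := by
  classical
  have := h.mono hST W hW
  rwa [Multiset.filter_eq_self.2 hS] at this

lemma NearIndep.card_finset_le {t : ℕ} {S : Finset V} {T : Multiset V} (h : NearIndep F t T)
    (hST : ∀ x ∈ S, x ∈ T)
    (W : Submodule F V) (hW : FiniteDimensional F W) (hS : ∀ x ∈ S, x ∈ W) :
    S.card ≤ Module.finrank F W + t := by
  classical
  exact h.card_le (S := S.val) ((Multiset.le_iff_subset S.nodup).2 hST) W hW hS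

lemma finrank_span_insert_le (x : V) (S : Set V) (hS : S.Finite) :
    Module.finrank F (Submodule.span F (insert x S)) ≤
      Module.finrank F (Submodule.span F S) + 1 := by
  have := FiniteDimensional.span_of_finite F hS
  have h1 := FiniteDimensional.span_of_finite F (Set.finite_singleton x)
  rw [Submodule.span_insert]
  have h := Submodule.finrank_add_le_finrank_add_finrank (Submodule.span F {x})
    (Submodule.span F S)
  have h2 := finrank_span_le_card (R := F) ({x} : Set V)
  simp only [Set.toFinset_singleton, Finset.card_singleton] at h2
  omega

/-- Along `ℓ`, all but `B` of the vectors of `D` that are not in the span of `e` and `ℓ` have a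
partner in `D'`. -/
def MatchedAlong (F : Type*) {V : Type*} [Field F] [AddCommGroup V] [Module F V]
    (e ℓ : V) (D D' : Finset V) (B : ℕ) : Prop :=
  ∃ K : Finset V, K.card ≤ B ∧ ∀ p ∈ D, p ∉ K → p ∉ Submodule.span F {e, ℓ} →
    ∃ q ∈ D', ∃ u c : F, u ≠ 0 ∧ c ≠ 0 ∧ q = u • p + c • ℓ

lemma NearIndep.exists_independent {t s : ℕ} {S : Finset V} {T : Multiset V}
    (h : NearIndep F t T) (hST : ∀ x ∈ S, x ∈ T) (hs : s + t ≤ S.card) :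
    ∃ v : Fin s → V, LinearIndependent F v ∧ ∀ i, v i ∈ S := by
  classical
  obtain ⟨b, hbS, hb, hli⟩ := exists_linearIndependent F (S : Set V)
  have hbfin : b.Finite := S.finite_toSet.subset hbS
  have := hbfin.fintype
  have h1 : Module.finrank F (Submodule.span F (S : Set V)) = Fintype.card b := by
    rw [← hb, finrank_span_set_eq_card hli, Set.toFinset_card]
  have h2 := h.card_finset_le hST (Submodule.span F (S : Set V))
    (FiniteDimensional.span_finset F S) (fun x hx => Submodule.subset_span hx)
  have h3 : s ≤ Fintype.card b := by omega
  obtain ⟨g⟩ : Nonempty (Fin s ↪ b) := by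
    rw [Function.Embedding.nonempty_iff_card_le]; simpa using h3
  exact ⟨fun i => (g i : V), hli.comp g g.injective, fun i => hbS (g i).2⟩

/-- Two finite sets of vectors, one of them nearly independent, that are matched along many
independent directions in both orders are small. -/
lemma card_le_of_matchedAlong {t s B : ℕ} (e : V) (D D' : Finset V) (a b : Fin s → V)
    (hli : LinearIndependent F (Sum.elim a b)) (hs : 2 * s + 1 + t < s * s)
    (hD : NearIndep F t D.val) (ha : ∀ i, MatchedAlong F e (a i) D D' B)
    (hb : ∀ j, MatchedAlong F e (b j) D' D B) :
    D.card ≤ s * B + (s * (s * (B * (2 + t))) + (2 * s + 1 + t)) := by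
  classical
  choose K hK hKm using ha
  choose K' hK' hKm' using hb
  have hfr : ∀ x y : V, FiniteDimensional F (Submodule.span F {x, y}) := fun x y =>
    FiniteDimensional.span_of_finite F (by simp)
  set L : Finset V := (Finset.univ.image a) ∪ (Finset.univ.image b) with hL
  have hLcard : L.card ≤ 2 * s := by
    refine (Finset.card_union_le _ _).trans ?_
    have h1 := Finset.card_image_le (s := Finset.univ) (f := a)
    have h2 := Finset.card_image_le (s := Finset.univ) (f := b)
    simp only [Finset.card_univ, Fintype.card_fin] at h1 h2
    omega
  have haL : ∀ i, a i ∈ L := fun i => by simp [hL]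
  have hbL : ∀ i, b i ∈ L := fun i => by simp [hL]
  have hspan : ∀ x : V, Module.finrank F (Submodule.span F (insert x (L : Set V))) ≤ 2 * s + 1 := by
    intro x
    have h1 := finrank_span_insert_le (F := F) x (L : Set V) L.finite_toSet
    have h2 := finrank_span_finset_le_card (R := F) L
    simp only [Set.finrank] at h2
    omega
  have hspanfin : ∀ x : V, FiniteDimensional F (Submodule.span F (insert x (L : Set V))) :=
    fun x => FiniteDimensional.span_of_finite F (L.finite_toSet.insert x)
  by_contra! hcon
  -- Three kinds of exceptions: `p` may lack a partner along some `a i`; its partner `q` may lack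
  -- one along some `b j`, and then `p` lies in the span of that exceptional `q` and `a i`; or `p`
  -- lies in the span of `e` and all directions. Near independence bounds the last two kinds.
  set bad : Finset V := Finset.univ.biUnion K ∪
    ((Finset.univ.biUnion fun i => Finset.univ.biUnion fun j => (K' j).biUnion fun q =>
      D.filter (· ∈ Submodule.span F {q, a i})) ∪
    D.filter (· ∈ Submodule.span F (insert e (L : Set V)))) with hbad
  have hbadcard : bad.card ≤ s * B + (s * (s * (B * (2 + t))) + (2 * s + 1 + t)) := by
    refine (Finset.card_union_le _ _).trans (add_le_add ?_ ?_)
    · simpa using Finset.card_biUnion_le_card_mul Finset.univ K B (fun i _ => hK i)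
    refine (Finset.card_union_le _ _).trans (add_le_add ?_ ?_)
    · refine (Finset.card_biUnion_le_card_mul _ _ (s * (B * (2 + t))) fun i _ => ?_).trans (by simp)
      refine (Finset.card_biUnion_le_card_mul _ _ (B * (2 + t)) fun j _ => ?_).trans (by simp)
      refine (Finset.card_biUnion_le_card_mul _ _ (2 + t) fun q _ => ?_).trans
        (Nat.mul_le_mul_right _ (hK' j))
      have h1 := hD.card_finset_le (S := D.filter (· ∈ Submodule.span F {q, a i}))
        (fun x hx => (Finset.mem_filter.1 hx).1) _ (hfr q (a i))
        (fun x hx => (Finset.mem_filter.1 hx).2)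
      have h2 := finrank_span_le_card (R := F) ({q, a i} : Set V)
      have h3 : ({q, a i} : Set V).toFinset.card ≤ 2 := by
        simpa using Finset.card_le_two (a := q) (b := a i)
      omega
    · have h1 := hD.card_finset_le (S := D.filter (· ∈ Submodule.span F (insert e (L : Set V))))
        (fun x hx => (Finset.mem_filter.1 hx).1) _ (hspanfin e)
        (fun x hx => (Finset.mem_filter.1 hx).2)
      have := hspan e
      omega
  obtain ⟨p, hpD, hp⟩ : ∃ p ∈ D, p ∉ bad := by
    by_contra! h
    exact absurd (Finset.card_le_card (fun x hx => h x hx : D ⊆ bad)) (by omega)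
  simp only [hbad, Finset.mem_union, Finset.mem_biUnion, Finset.mem_univ, true_and,
    Finset.mem_filter, not_or, not_exists, not_and] at hp
  obtain ⟨hp1, hp2, hp3⟩ := hp
  have hp3 := hp3 hpD
  have hsub : ∀ ℓ ∈ L, Submodule.span F {e, ℓ} ≤ Submodule.span F (insert e (L : Set V)) := by
    intro ℓ hℓ
    refine Submodule.span_mono ?_
    rintro x (rfl | rfl)
    · exact Set.mem_insert _ _
    · exact Set.mem_insert_of_mem _ hℓ
  have hLmem : ∀ ℓ ∈ L, ℓ ∈ Submodule.span F (insert e (L : Set V)) := fun ℓ hℓ =>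
    Submodule.subset_span (Set.mem_insert_of_mem _ hℓ)
  have hq : ∀ i, ∃ q ∈ D', ∃ u c : F, u ≠ 0 ∧ c ≠ 0 ∧ q = u • p + c • a i := fun i =>
    hKm i p hpD (hp1 i) (fun h => hp3 (hsub _ (haL i) h))
  choose q hqD u c hu hc hqe using hq
  have hpq : ∀ i, p = (u i)⁻¹ • q i + (-((u i)⁻¹ * c i)) • a i := by
    intro i
    rw [hqe i, smul_add, smul_smul, smul_smul, inv_mul_cancel₀ (hu i), neg_smul, one_smul]
    abel
  have hr : ∀ i j, ∃ r ∈ D, ∃ v d : F, v ≠ 0 ∧ d ≠ 0 ∧ r = v • q i + d • b j := by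
    intro i j
    refine hKm' j (q i) (hqD i) (fun h => ?_) (fun h => hp3 ?_)
    · refine hp2 i j (q i) h hpD ?_
      rw [Submodule.mem_span_pair]
      exact ⟨_, _, (hpq i).symm⟩
    · rw [hpq i]
      exact add_mem (Submodule.smul_mem _ _ (hsub _ (hbL j) h))
        (Submodule.smul_mem _ _ (hLmem _ (haL i)))
  choose r hrD v d hv hd hre using hr
  have hre' : ∀ i j, r i j = (v i j * u i) • p + (v i j * c i) • a i + d i j • b j := by
    intro i j
    rw [hre, hqe, smul_add, smul_smul, smul_smul]
  have hpL : p ∉ Submodule.span F (Set.range (Sum.elim a b)) := by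
    intro h
    refine hp3 (Submodule.span_mono ?_ h)
    rintro x ⟨y | y, rfl⟩
    · exact Set.mem_insert_of_mem _ (haL y)
    · exact Set.mem_insert_of_mem _ (hbL y)
  have hli' := hli.option hpL
  -- In coordinates for the independent family `p, a, b`, the vector `r i j` has its only non-zero
  -- `a`-coordinate at `i` and its only non-zero `b`-coordinate at `j`.
  have hinj : Function.Injective fun x : Fin s × Fin s => r x.1 x.2 := by
    rintro ⟨i, j⟩ ⟨i', j'⟩ h
    have hinj := hli'
    rw [LinearIndependent] at hinj
    have hrep : ∀ i j, r i j = Finsupp.linearCombination F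
        (fun o : Option (Fin s ⊕ Fin s) => Option.casesOn' o p (Sum.elim a b))
        (Finsupp.single none (v i j * u i) + Finsupp.single (some (Sum.inl i)) (v i j * c i)
          + Finsupp.single (some (Sum.inr j)) (d i j)) := by
      intro i j
      simp only [map_add, Finsupp.linearCombination_single, hre', Option.casesOn'_none,
        Option.casesOn'_some, Sum.elim_inl, Sum.elim_inr]
    simp only at h
    rw [hrep, hrep] at h
    have h := hinj h
    have e1 := DFunLike.congr_fun h (some (Sum.inl i))
    have e2 := DFunLike.congr_fun h (some (Sum.inr j))
    simp only [Finsupp.add_apply, Finsupp.single_apply] at e1 e2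
    have h1 : i' = i := by
      by_contra hne
      simp [hne, hv, hc] at e1
    have h2 : j' = j := by
      by_contra hne
      simp [hne, hd] at e2
    rw [h1, h2]
  -- Going out along `a i` and back along `b j` gives `s * s` members of `D` in a space of dimension
  -- at most `2 * s + 1`, against `hs`.
  have hfin := hD.card_finset_le (S := Finset.univ.image fun x : Fin s × Fin s => r x.1 x.2)
    (fun x hx => by
      obtain ⟨y, -, rfl⟩ := Finset.mem_image.1 hx
      exact hrD _ _) _ (hspanfin p)
    (fun x hx => by
      obtain ⟨y, -, rfl⟩ := Finset.mem_image.1 hx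
      rw [hre']
      refine add_mem (add_mem ?_ ?_) ?_ <;> refine Submodule.smul_mem _ _ (Submodule.subset_span ?_)
      · exact Set.mem_insert _ _
      · exact Set.mem_insert_of_mem _ (haL _)
      · exact Set.mem_insert_of_mem _ (hbL _))
  rw [Finset.card_image_of_injective _ hinj] at hfin
  have := hspan p
  simp only [Finset.card_univ, Fintype.card_prod, Fintype.card_fin] at hfin
  omega

end NearIndependence

/-! ### Affine linear forms and elimination of a variable -/

section LinearForms

variable {F : Type*} [Field F] {σ : Type*}

lemma irreducible_of_totalDegree_one {p : MvPolynomial σ F} (hp : p.totalDegree = 1) :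
    Irreducible p := by
  refine MvPolynomial.irreducible_of_totalDegree_eq_one hp fun x hx => ?_
  have hp0 : p ≠ 0 := by rintro rfl; simp at hp
  obtain ⟨i, hi⟩ := MvPolynomial.ne_zero_iff.1 hp0
  refine isUnit_iff_ne_zero.2 ?_
  rintro rfl
  exact hi (zero_dvd_iff.1 (hx i))

lemma prime_of_totalDegree_one {p : MvPolynomial σ F} (hp : p.totalDegree = 1) : Prime p :=
  (irreducible_of_totalDegree_one hp).prime

lemma exists_smul_of_associated {p q : MvPolynomial σ F} (h : Associated p q) :
    ∃ u : F, u ≠ 0 ∧ q = u • p := by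
  obtain ⟨v, rfl⟩ := h
  obtain ⟨u, hu, hv⟩ := MvPolynomial.isUnit_iff_eq_C_of_isReduced.1 v.isUnit
  exact ⟨u, hu.ne_zero, by rw [hv, MvPolynomial.smul_eq_C_mul, mul_comm]⟩

lemma associated_smul {u : F} (hu : u ≠ 0) (p : MvPolynomial σ F) : Associated p (u • p) := by
  have h : IsUnit (MvPolynomial.C u : MvPolynomial σ F) :=
    (isUnit_iff_ne_zero.2 hu).map MvPolynomial.C
  rw [MvPolynomial.smul_eq_C_mul]
  obtain ⟨w, hw⟩ := h
  exact ⟨w, by rw [hw, mul_comm]⟩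

lemma totalDegree_eq_of_associated {p q : MvPolynomial σ F} (h : Associated p q) :
    p.totalDegree = q.totalDegree := by
  by_cases hp : p = 0
  · subst hp
    rw [associated_zero_iff_eq_zero q |>.1 h.symm]
  have hq : q ≠ 0 := h.ne_zero_iff.1 hp
  exact le_antisymm (MvPolynomial.totalDegree_le_of_dvd_of_isDomain h.dvd hq)
    (MvPolynomial.totalDegree_le_of_dvd_of_isDomain h.symm.dvd hp)

lemma totalDegree_multiset_prod_of_linear (S : Multiset (MvPolynomial σ F))
    (hS : ∀ p ∈ S, p.totalDegree = 1) : S.prod.totalDegree = S.card := by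
  induction S using Multiset.induction_on with
  | empty => simp
  | cons a S ih =>
    have ha := hS a (Multiset.mem_cons_self _ _)
    have hS' := fun p hp => hS p (Multiset.mem_cons_of_mem hp)
    rw [Multiset.prod_cons, MvPolynomial.totalDegree_mul_of_isDomain, ih hS', ha,
      Multiset.card_cons, add_comm]
    · rintro rfl; simp at ha
    · exact Multiset.prod_ne_zero fun h => by simpa using hS' 0 h

lemma eq_zero_or_single_of_mem_support {p : MvPolynomial σ F} (hp : p.totalDegree ≤ 1)
    {d : σ →₀ ℕ} (hd : d ∈ p.support) : d = 0 ∨ ∃ v, d = Finsupp.single v 1 := by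
  have h := (MvPolynomial.le_totalDegree hd).trans hp
  rcases Nat.le_one_iff_eq_zero_or_eq_one.1 h with h | h
  · left
    ext i
    by_contra hi
    exact hi ((Finset.sum_eq_zero_iff.1 h) i (Finsupp.mem_support_iff.2 hi))
  · right
    exact (Finsupp.sum_eq_one_iff d).1 h

lemma exists_single_of_totalDegree_one {ℓ : MvPolynomial σ F} (hℓ : ℓ.totalDegree = 1) :
    ∃ v, ℓ.coeff (Finsupp.single v 1) ≠ 0 := by
  by_contra! h
  have : ℓ.totalDegree ≤ 0 := by
    refine Finset.sup_le fun d hd => ?_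
    rcases eq_zero_or_single_of_mem_support hℓ.le hd with rfl | ⟨v, rfl⟩
    · simp
    · exact absurd (h v) (MvPolynomial.mem_support_iff.1 hd)
  omega

/-- Eliminating a variable by a linear equation `ℓ = 0`. -/
lemma exists_linear_elimination {ℓ : MvPolynomial σ F} (hℓ : ℓ.totalDegree = 1) :
    ∃ φ : MvPolynomial σ F →ₐ[F] MvPolynomial σ F, φ ℓ = 0 ∧ (∀ p, ℓ ∣ p - φ p) ∧
      ∀ p, p.totalDegree ≤ 1 → (φ p).totalDegree ≤ 1 ∧ ∃ c : F, p = φ p + c • ℓ := by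
  classical
  obtain ⟨v, hv⟩ := exists_single_of_totalDegree_one hℓ
  set a := ℓ.coeff (Finsupp.single v 1) with ha
  set g : σ → MvPolynomial σ F := fun i =>
    if i = v then MvPolynomial.X v - a⁻¹ • ℓ else MvPolynomial.X i with hg
  have hlin : ∀ p : MvPolynomial σ F, p.totalDegree ≤ 1 →
      MvPolynomial.aeval g p = p - (p.coeff (Finsupp.single v 1) * a⁻¹) • ℓ := by
    intro p hp
    -- On affine polynomials the substitution agrees with this linear map; by linearity it suffices
    -- to compare them on constants and on single variables.
    set B : MvPolynomial σ F →ₗ[F] MvPolynomial σ F :=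
      LinearMap.id - (MvPolynomial.lcoeff (R := F) (Finsupp.single v 1)).smulRight (a⁻¹ • ℓ) with hB
    have hBp : ∀ p, B p = p - (p.coeff (Finsupp.single v 1) * a⁻¹) • ℓ := fun p => by
      simp [hB, MvPolynomial.lcoeff, smul_smul]
    rw [← hBp]
    conv_lhs => rw [p.as_sum]
    conv_rhs => rw [p.as_sum]
    rw [map_sum, map_sum]
    refine Finset.sum_congr rfl fun d hd => ?_
    rw [hBp]
    rcases eq_zero_or_single_of_mem_support hp hd with rfl | ⟨w, rfl⟩
    · have : (0 : σ →₀ ℕ) ≠ Finsupp.single v 1 := by simp [eq_comm]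
      simp [this]
    · rw [MvPolynomial.aeval_monomial, Finsupp.prod_single_index (by simp), pow_one,
        MvPolynomial.coeff_monomial, MvPolynomial.algebraMap_eq, hg]
      by_cases hw : w = v
      · subst hw
        simp only [if_true]
        rw [mul_sub, MvPolynomial.C_mul_X_eq_monomial, ← MvPolynomial.smul_eq_C_mul, smul_smul]
      · have : Finsupp.single w 1 ≠ Finsupp.single v 1 := fun h =>
          hw (Finsupp.single_left_injective one_ne_zero h)
        simp only [hw, this, if_false, zero_mul, zero_smul, sub_zero]
        rw [MvPolynomial.C_mul_X_eq_monomial]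
  refine ⟨MvPolynomial.aeval g, ?_, fun p => ?_, fun p hp => ⟨?_, ?_⟩⟩
  · rw [hlin ℓ hℓ.le, ← ha, mul_inv_cancel₀ hv, one_smul, sub_self]
  -- The substitution is the identity modulo `ℓ`, because it is so on the variables.
  · rw [← Ideal.mem_span_singleton, ← Ideal.Quotient.eq]
    have : (Ideal.Quotient.mkₐ F (Ideal.span {ℓ})) =
        (Ideal.Quotient.mkₐ F (Ideal.span {ℓ})).comp (MvPolynomial.aeval g) := by
      refine MvPolynomial.algHom_ext fun i => ?_
      rw [AlgHom.comp_apply, MvPolynomial.aeval_X]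
      simp only [Ideal.Quotient.mkₐ_eq_mk]
      rw [Ideal.Quotient.eq, Ideal.mem_span_singleton, hg]
      by_cases hi : i = v
      · subst hi
        simp only [if_true, sub_sub_cancel]
        exact Dvd.intro_left _ (MvPolynomial.smul_eq_C_mul _ _).symm
      · simp [hi]
    simpa using DFunLike.congr_fun this p
  · rw [hlin p hp]
    refine (MvPolynomial.totalDegree_sub _ _).trans (max_le hp ?_)
    exact (MvPolynomial.totalDegree_smul_le _ _).trans hℓ.le
  · exact ⟨_, by rw [hlin p hp, sub_add_cancel]⟩

end LinearForms

/-- A choice of normal forms up to units for polynomials. -/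
@[reducible] noncomputable def mvPolynomialNormalization {F : Type*} [Field F] {σ : Type*} :
    StrongNormalizationMonoid (MvPolynomial σ F) :=
  UniqueFactorizationMonoid.strongNormalizationMonoid

/-! ### Products of linear forms under substitution -/

section LinearProducts

attribute [local instance] mvPolynomialNormalization

variable {F : Type*} [Field F] {σ : Type*}

/-- A non-zero polynomial all of whose irreducible factors have degree one, and whose factors
are independent up to defect `t`. -/
structure IsLinearProduct (t : ℕ) (M : MvPolynomial σ F) : Prop where
  ne_zero : M ≠ 0
  totalDegree_eq : ∀ p ∈ normalizedFactors M, p.totalDegree = 1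
  nearIndep : NearIndep F t (normalizedFactors M)

lemma normalizedFactors_of_totalDegree_one {p : MvPolynomial σ F} (hp : p.totalDegree = 1) :
    normalizedFactors p = {normalize p} :=
  normalizedFactors_irreducible (irreducible_of_totalDegree_one hp)

lemma totalDegree_normalize (p : MvPolynomial σ F) :
    (normalize p).totalDegree = p.totalDegree :=
  totalDegree_eq_of_associated (normalize_associated p)

lemma mem_normalizedFactors_of_dvd {M ℓ : MvPolynomial σ F} (hM : M ≠ 0)
    (hℓ : ℓ.totalDegree = 1) (hn : normalize ℓ = ℓ) (h : ℓ ∣ M) : ℓ ∈ normalizedFactors M := by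
  obtain ⟨q, hq, hqa⟩ := exists_mem_normalizedFactors_of_dvd hM (irreducible_of_totalDegree_one hℓ) h
  have : ℓ = q := by
    rw [← hn, ← normalize_normalized_factor q hq]
    exact normalize_eq_normalize_iff_associated.2 hqa
  exact this ▸ hq

open scoped Classical in
/-- The factors of the image of a product of linear forms under a substitution. -/
lemma normalizedFactors_map {φ : MvPolynomial σ F →ₐ[F] MvPolynomial σ F}
    (hφ : ∀ p : MvPolynomial σ F, p.totalDegree ≤ 1 → (φ p).totalDegree ≤ 1)
    {M : MvPolynomial σ F} (hM : ∀ p ∈ normalizedFactors M, p.totalDegree = 1) (h0 : φ M ≠ 0) :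
    normalizedFactors (φ M) =
      ((normalizedFactors M).filter fun p => (φ p).totalDegree = 1).map fun p => normalize (φ p) := by
  have hM0 : M ≠ 0 := by rintro rfl; simp at h0
  have h1 : Associated (φ (normalizedFactors M).prod) (φ M) := (prod_normalizedFactors hM0).map φ
  rw [← h1.normalizedFactors_eq, map_multiset_prod]
  have h2 : ((normalizedFactors M).map φ).prod ≠ 0 := by
    rw [← map_multiset_prod]; exact h1.ne_zero_iff.2 h0
  have key : ∀ S : Multiset (MvPolynomial σ F), (∀ p ∈ S, p.totalDegree = 1) →
      (S.map φ).prod ≠ 0 → normalizedFactors (S.map φ).prod =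
        (S.filter fun p => (φ p).totalDegree = 1).map fun p => normalize (φ p) := by
    intro S
    induction S using Multiset.induction_on with
    | empty => simp
    | cons a S ih =>
      intro hS hne
      rw [Multiset.map_cons, Multiset.prod_cons] at hne ⊢
      rw [normalizedFactors_mul (left_ne_zero_of_mul hne) (right_ne_zero_of_mul hne),
        ih (fun p hp => hS p (Multiset.mem_cons_of_mem hp)) (right_ne_zero_of_mul hne)]
      have ha := hφ a (hS a (Multiset.mem_cons_self _ _)).le
      by_cases h : (φ a).totalDegree = 1
      · rw [normalizedFactors_of_totalDegree_one h, Multiset.filter_cons_of_pos (p := fun p => (φ p).totalDegree = 1) _ h,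
          Multiset.map_cons, Multiset.singleton_add]
      -- A factor whose image is no longer of degree one has become a non-zero constant, a unit, and
      -- drops out.
      · rw [Multiset.filter_cons_of_neg (p := fun p => (φ p).totalDegree = 1) _ h, normalizedFactors_of_isUnit, zero_add]
        rw [MvPolynomial.isUnit_iff_totalDegree_of_isReduced]
        have h3 : (φ a).totalDegree = 0 := by omega
        refine ⟨?_, h3⟩
        rw [MvPolynomial.totalDegree_eq_zero_iff_eq_C] at h3
        have := left_ne_zero_of_mul hne
        rw [h3] at this
        rw [isUnit_iff_ne_zero]
        intro h4
        simp [h4] at this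
  exact key _ hM h2

/-- A factor whose image lies in `W` itself lies in `W` plus the line through `ℓ`; this extra
dimension is the extra unit of defect. -/
lemma IsLinearProduct.map {t : ℕ} {M ℓ : MvPolynomial σ F} (hM : IsLinearProduct t M)
    {φ : MvPolynomial σ F →ₐ[F] MvPolynomial σ F}
    (hφ : ∀ p, p.totalDegree ≤ 1 → (φ p).totalDegree ≤ 1 ∧ ∃ c : F, p = φ p + c • ℓ)
    (h0 : φ M ≠ 0) : IsLinearProduct (t + 1) (φ M) := by
  classical
  have hnf := normalizedFactors_map (fun p hp => (hφ p hp).1) hM.totalDegree_eq h0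
  refine ⟨h0, fun p hp => ?_, fun W hW => ?_⟩
  · rw [hnf, Multiset.mem_map] at hp
    obtain ⟨q, hq, rfl⟩ := hp
    rw [totalDegree_normalize]
    exact (Multiset.mem_filter.1 hq).2
  · rw [hnf, Multiset.filter_map, Multiset.card_map]
    have hfin : FiniteDimensional F (Submodule.span F {ℓ}) :=
      FiniteDimensional.span_of_finite F (Set.finite_singleton ℓ)
    have h1 := hM.nearIndep.card_le (S := Multiset.filter
        ((fun x => x ∈ W) ∘ fun p => normalize (φ p))
        (Multiset.filter (fun p => (φ p).totalDegree = 1) (normalizedFactors M)))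
      ((Multiset.filter_le _ _).trans (Multiset.filter_le _ _)) (W ⊔ Submodule.span F {ℓ})
      inferInstance ?_
    · have h2 := Submodule.finrank_add_le_finrank_add_finrank W (Submodule.span F {ℓ})
      have h3 := finrank_span_le_card (R := F) ({ℓ} : Set (MvPolynomial σ F))
      simp only [Set.toFinset_singleton, Finset.card_singleton] at h3
      omega
    · intro x hx
      simp only [Multiset.mem_filter, Function.comp_apply] at hx
      obtain ⟨⟨hx1, -⟩, hx3⟩ := hx
      obtain ⟨-, c, hc⟩ := hφ x (hM.totalDegree_eq x hx1).le
      obtain ⟨u, -, hu⟩ := exists_smul_of_associated (normalize_associated (φ x))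
      rw [hc, hu]
      exact add_mem (Submodule.smul_mem _ _ (Submodule.mem_sup_left hx3))
        (Submodule.smul_mem _ _ (Submodule.mem_sup_right (Submodule.mem_span_singleton_self ℓ)))

/-- The common part of `S` and `S'` contributes equally to both images, so the images differ as
those of `S - S'` and `S' - S` do. An element of the former whose image is missed by the latter
cannot cancel. -/
lemma card_toFinset_filter_not_mem_le {α β : Type*} [DecidableEq α] [DecidableEq β]
    (S S' : Multiset α) (f : α → β) (h : α → Prop) [DecidablePred h] :
    ((S - S').toFinset.filter fun p => h p ∧ ∀ q ∈ S' - S, h q → f q ≠ f p).card ≤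
      ((S.filter h).map f - (S'.filter h).map f).card := by
  have hadd : (S.filter h).map f + ((S' - S).filter h).map f =
      (S'.filter h).map f + ((S - S').filter h).map f := by
    rw [← Multiset.map_add, ← Multiset.map_add, ← Multiset.filter_add, ← Multiset.filter_add]
    congr 2
    ext a
    simp only [Multiset.count_add, Multiset.count_sub]
    omega
  have hle : (((S - S').toFinset.filter fun p => h p ∧ ∀ q ∈ S' - S, h q → f q ≠ f p).val.map f) ≤
      (S.filter h).map f - (S'.filter h).map f := by
    rw [Multiset.le_iff_count]
    intro x
    have hx := congrArg (Multiset.count x) hadd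
    simp only [Multiset.count_add, Multiset.count_sub] at hx ⊢
    by_cases hex : x ∈ ((S' - S).filter h).map f
    · rw [Multiset.count_eq_zero_of_notMem]
      · exact Nat.zero_le _
      · intro hx'
        obtain ⟨p, hp, hpx⟩ := Multiset.mem_map.1 hx'
        obtain ⟨q, hq, hqx⟩ := Multiset.mem_map.1 hex
        obtain ⟨hq1, hq2⟩ := Multiset.mem_filter.1 hq
        obtain ⟨-, -, hp3⟩ := Finset.mem_filter.1 (Finset.mem_def.2 hp)
        exact hp3 q hq1 hq2 (hqx.trans hpx.symm)
    · rw [Multiset.count_eq_zero_of_notMem hex] at hx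
      have h1 : Multiset.count x (((S - S').toFinset.filter fun p =>
          h p ∧ ∀ q ∈ S' - S, h q → f q ≠ f p).val.map f) ≤
          Multiset.count x (((S - S').filter h).map f) := by
        refine Multiset.count_le_of_le x (Multiset.map_le_map ?_)
        rw [Multiset.le_iff_subset (Finset.nodup _)]
        intro y hy
        obtain ⟨hy1, hy2, -⟩ := Finset.mem_filter.1 (Finset.mem_def.2 hy)
        exact Multiset.mem_filter.2 ⟨Multiset.mem_toFinset.1 hy1, hy2⟩
      omega
  have := Multiset.card_le_card hle
  rwa [Multiset.card_map] at this

/-- Modulo `ℓ` almost every factor in excess in `M` becomes associated to one in excess in `M'`;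
lifting back adds a multiple of `ℓ`. The vector `e = 1` takes care of the factors that become
constant modulo `ℓ`. -/
lemma matchedAlong_of_card_sub_le [DecidableEq (MvPolynomial σ F)] {B : ℕ}
    {M M' ℓ : MvPolynomial σ F}
    (hM : ∀ p ∈ normalizedFactors M, p.totalDegree = 1)
    (hM' : ∀ p ∈ normalizedFactors M', p.totalDegree = 1)
    {φ : MvPolynomial σ F →ₐ[F] MvPolynomial σ F}
    (hφ : ∀ p, p.totalDegree ≤ 1 → (φ p).totalDegree ≤ 1 ∧ ∃ c : F, p = φ p + c • ℓ)
    (h0 : φ M ≠ 0) (h0' : φ M' ≠ 0)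
    (h : (normalizedFactors (φ M) - normalizedFactors (φ M')).card ≤ B) :
    MatchedAlong F 1 ℓ (normalizedFactors M - normalizedFactors M').toFinset
      (normalizedFactors M' - normalizedFactors M).toFinset B := by
  classical
  rw [normalizedFactors_map (fun p hp => (hφ p hp).1) hM h0,
    normalizedFactors_map (fun p hp => (hφ p hp).1) hM' h0'] at h
  refine ⟨_, (card_toFinset_filter_not_mem_le (normalizedFactors M) (normalizedFactors M')
    (fun p => normalize (φ p)) (fun p => (φ p).totalDegree = 1)).trans (le_trans (le_of_eq ?_) h),
    fun p hp hpK hps => ?_⟩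
  · congr!
  have hpM : p ∈ normalizedFactors M := Multiset.mem_of_le (Multiset.sub_le_self _ _)
    (Multiset.mem_toFinset.1 hp)
  obtain ⟨hpd, c, hc⟩ := hφ p (hM p hpM).le
  have hpd1 : (φ p).totalDegree = 1 := by
    by_contra hne
    have : (φ p).totalDegree = 0 := by omega
    rw [MvPolynomial.totalDegree_eq_zero_iff_eq_C] at this
    refine hps (Submodule.mem_span_pair.2 ⟨(φ p).coeff 0, c, ?_⟩)
    rw [MvPolynomial.smul_eq_C_mul, mul_one, ← this, ← hc]
  simp only [Finset.mem_filter, hp, true_and, hpd1, not_forall, not_not] at hpK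
  obtain ⟨q, hq, hqd, hqp⟩ := hpK
  have hqM : q ∈ normalizedFactors M' := Multiset.mem_of_le (Multiset.sub_le_self _ _) hq
  obtain ⟨-, c', hc'⟩ := hφ q (hM' q hqM).le
  obtain ⟨u, hu, hpq⟩ := exists_smul_of_associated (normalize_eq_normalize_iff_associated.1 hqp.symm)
  have hqe : q = u • p + (c' - u * c) • ℓ := by
    conv_lhs => rw [hc', hpq]
    conv_rhs => rw [hc]
    rw [smul_add, smul_smul, sub_smul]
    abel
  refine ⟨q, Multiset.mem_toFinset.2 hq, u, c' - u * c, hu, fun h => ?_, hqe⟩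
  -- Without the term in `ℓ`, the normalized factors `p` and `q` would be equal, but no element is
  -- in excess on both sides.
  rw [h, zero_smul, add_zero] at hqe
  have hass : Associated p q := hqe ▸ associated_smul hu p
  have heq : p = q := by
    rw [← normalize_normalized_factor p hpM, ← normalize_normalized_factor q hqM]
    exact normalize_eq_normalize_iff_associated.2 hass
  subst heq
  have h1 := Multiset.count_pos.2 hq
  have h2 := Multiset.count_pos.2 (Multiset.mem_toFinset.1 hp)
  rw [Multiset.count_sub] at h1 h2
  omega

end LinearProducts

/-! ### Minimal vanishing subsums -/

section ZeroSums

lemma exists_minimal_zero_sum {ι A : Type*} [AddCommMonoid A] (g : ι → A) (S : Finset ι)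
    (hS : S.Nonempty) (h0 : ∑ i ∈ S, g i = 0) :
    ∃ T ⊆ S, T.Nonempty ∧ ∑ i ∈ T, g i = 0 ∧
      ∀ U ⊆ T, U.Nonempty → U ≠ T → ∑ i ∈ U, g i ≠ 0 := by
  classical
  induction S using Finset.strongInduction with
  | H S ih =>
    by_cases h : ∀ U ⊆ S, U.Nonempty → U ≠ S → ∑ i ∈ U, g i ≠ 0
    · exact ⟨S, subset_rfl, hS, h0, h⟩
    · push Not at h
      obtain ⟨U, hUS, hU, hne, hU0⟩ := h
      obtain ⟨T, hT, h⟩ := ih U (hUS.ssubset_of_ne hne) hU hU0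
      exact ⟨T, hT.trans hUS, h⟩

end ZeroSums

/-! ### Differences within minimal vanishing sums of linear products -/

section RankBound

attribute [local instance] mvPolynomialNormalization

variable {F : Type*} [Field F] {σ : Type*}

/-- The directions `a` carry factors from `M` to `M'` and the directions `b` carry them back. The
final `+ t` pays for repeated factors. -/
lemma card_sub_le_of_many_reductions [DecidableEq (MvPolynomial σ F)] {t s B : ℕ}
    {M M' : MvPolynomial σ F} (hM : IsLinearProduct t M) (hM' : IsLinearProduct t M')
    (hs : 2 * s + 1 + t < s * s) (a b : Fin s → MvPolynomial σ F)
    (hli : LinearIndependent F (Sum.elim a b))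
    (ha : ∀ x, ∃ φ : MvPolynomial σ F →ₐ[F] MvPolynomial σ F,
      (∀ p, p.totalDegree ≤ 1 → (φ p).totalDegree ≤ 1 ∧
        ∃ c : F, p = φ p + c • Sum.elim a b x) ∧ φ M ≠ 0 ∧ φ M' ≠ 0 ∧
      (normalizedFactors (φ M) - normalizedFactors (φ M')).card ≤ B ∧
      (normalizedFactors (φ M') - normalizedFactors (φ M)).card ≤ B) :
    (normalizedFactors M - normalizedFactors M').card ≤
      s * B + (s * (s * (B * (2 + t))) + (2 * s + 1 + t)) + t := by
  have h1 := card_le_of_matchedAlong (F := F) 1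
    (normalizedFactors M - normalizedFactors M').toFinset
    (normalizedFactors M' - normalizedFactors M).toFinset a b hli hs
    (hM.nearIndep.mono (Multiset.dedup_le _ |>.trans (Multiset.sub_le_self _ _)))
    (fun i => by
      obtain ⟨φ, hφ, h0, h0', h, -⟩ := ha (Sum.inl i)
      exact matchedAlong_of_card_sub_le hM.totalDegree_eq hM'.totalDegree_eq hφ h0 h0' h)
    (fun i => by
      obtain ⟨φ, hφ, h0, h0', -, h⟩ := ha (Sum.inr i)
      exact matchedAlong_of_card_sub_le hM'.totalDegree_eq hM.totalDegree_eq hφ h0' h0 h)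
  have h2 := (hM.nearIndep.mono (Multiset.sub_le_self _ _)).card_le le_rfl
    (Submodule.span F ((normalizedFactors M - normalizedFactors M').toFinset :
      Set (MvPolynomial σ F))) (FiniteDimensional.span_finset F _)
    (fun x hx => Submodule.subset_span (by simpa using hx))
  have h3 := finrank_span_finset_le_card (R := F)
    (normalizedFactors M - normalizedFactors M').toFinset
  simp only [Set.finrank] at h3
  omega

/-- A non-zero sum of nearly equal products of linear forms has few divisors among the linear
forms that divide none of the summands. -/
lemma card_le_of_dvd_sum [DecidableEq (MvPolynomial σ F)] {ι : Type*} {t N : ℕ}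
    (M : ι → MvPolynomial σ F) (A : Finset ι) (hM : ∀ i ∈ A, IsLinearProduct t (M i))
    (hN : ∀ i ∈ A, ∀ j ∈ A, (normalizedFactors (M i) - normalizedFactors (M j)).card ≤ N)
    (h0 : ∑ i ∈ A, M i ≠ 0) (T : Finset (MvPolynomial σ F))
    (hT : ∀ ℓ ∈ T, ℓ.totalDegree = 1 ∧ normalize ℓ = ℓ ∧ ℓ ∣ ∑ i ∈ A, M i ∧ ∀ i ∈ A, ¬ ℓ ∣ M i) :
    T.card ≤ (A.card + 1) * N := by
  obtain ⟨i₀, hi₀⟩ : A.Nonempty := by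
    by_contra h
    rw [Finset.not_nonempty_iff_eq_empty] at h
    simp [h] at h0
  -- `H` divides every summand and omits at most `A.card * N` factors of `M i₀`, so each cofactor
  -- has degree at most `(A.card + 1) * N`.
  set H := normalizedFactors (M i₀) -
    ∑ j ∈ A, (normalizedFactors (M i₀) - normalizedFactors (M j)) with hH
  have hHle : ∀ j ∈ A, H ≤ normalizedFactors (M j) := by
    intro j hj
    rw [hH]
    refine le_trans (tsub_le_tsub_left (Finset.single_le_sum
      (f := fun j => normalizedFactors (M i₀) - normalizedFactors (M j))
      (fun _ _ => Multiset.zero_le _) hj) _) ?_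
    exact tsub_tsub_le
  have hHcard : (normalizedFactors (M i₀)).card ≤ H.card + A.card * N := by
    have h1 : normalizedFactors (M i₀) ≤ H +
      ∑ j ∈ A, (normalizedFactors (M i₀) - normalizedFactors (M j)) := le_tsub_add
    have h2 := Multiset.card_le_card h1
    rw [Multiset.card_add, Multiset.card_sum] at h2
    have h3 := Finset.sum_le_card_nsmul A _ N (fun j hj => hN i₀ hi₀ j hj)
    rw [smul_eq_mul] at h3
    omega
  have hdvd : ∀ j ∈ A, ∃ Q, M j = H.prod * Q ∧ Q.totalDegree ≤ (A.card + 1) * N := by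
    intro j hj
    have hMj := hM j hj
    obtain ⟨Q, hQ⟩ := (Multiset.prod_dvd_prod_of_le (hHle j hj)).trans
      (prod_normalizedFactors hMj.ne_zero).dvd
    refine ⟨Q, hQ, ?_⟩
    have h1 : (M j).totalDegree = (normalizedFactors (M j)).card := by
      rw [← totalDegree_eq_of_associated (prod_normalizedFactors hMj.ne_zero),
        totalDegree_multiset_prod_of_linear _ hMj.totalDegree_eq]
    have h2 : H.prod.totalDegree = H.card := totalDegree_multiset_prod_of_linear _
      fun p hp => hMj.totalDegree_eq p (Multiset.mem_of_le (hHle j hj) hp)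
    have hne := hMj.ne_zero
    rw [hQ] at hne
    have h3 := congrArg MvPolynomial.totalDegree hQ
    rw [MvPolynomial.totalDegree_mul_of_isDomain (left_ne_zero_of_mul hne)
      (right_ne_zero_of_mul hne)] at h3
    have h4 := Multiset.card_le_card (le_tsub_add :
      normalizedFactors (M j) ≤ (normalizedFactors (M j) - normalizedFactors (M i₀)) +
        normalizedFactors (M i₀))
    rw [Multiset.card_add] at h4
    have h5 := hN j hj i₀ hi₀
    rw [add_mul]
    omega
  choose! Q hQ hQd using hdvd
  have hsum : ∑ i ∈ A, M i = H.prod * ∑ i ∈ A, Q i := by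
    rw [Finset.mul_sum]
    exact Finset.sum_congr rfl hQ
  have hQ0 : ∑ i ∈ A, Q i ≠ 0 := by
    rw [hsum] at h0
    exact right_ne_zero_of_mul h0
  -- The forms in `T` are pairwise coprime and do not divide `H.prod`, so their product divides the
  -- cofactor.
  have hprod : ∏ ℓ ∈ T, ℓ ∣ ∑ i ∈ A, Q i := by
    refine Finset.prod_dvd_of_isRelPrime ?_ ?_
    · intro x hx y hy hxy
      rw [Function.onFun, (irreducible_of_totalDegree_one (hT x hx).1).isRelPrime_iff_not_dvd]
      intro h
      refine hxy ?_
      rw [← (hT x hx).2.1, ← (hT y hy).2.1]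
      exact normalize_eq_normalize_iff_associated.2
        ((irreducible_of_totalDegree_one (hT x hx).1).associated_of_dvd
          (irreducible_of_totalDegree_one (hT y hy).1) h)
    · intro ℓ hℓ
      obtain ⟨h1, -, h3, h4⟩ := hT ℓ hℓ
      rw [hsum] at h3
      refine ((prime_of_totalDegree_one h1).dvd_or_dvd h3).resolve_left fun h => h4 i₀ hi₀ ?_
      rw [hQ i₀ hi₀]
      exact h.mul_right _
  have h1 := MvPolynomial.totalDegree_le_of_dvd_of_isDomain hprod hQ0
  have h2 : (∏ ℓ ∈ T, ℓ).totalDegree = T.card := by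
    have := totalDegree_multiset_prod_of_linear T.val (fun p hp => (hT p hp).1)
    rwa [Finset.prod_eq_multiset_prod, Multiset.map_id']
  rw [← h2]
  exact h1.trans (MvPolynomial.totalDegree_finsetSum_le hQd)

/-- The distinct members of `S` span a space of dimension at most their number, so there are at most
`t` repetitions. -/
lemma NearIndep.card_sub_le {V : Type*} [AddCommGroup V] [Module F V] [DecidableEq V] {t : ℕ}
    {S : Multiset V} (hS : NearIndep F t S) (S' : Multiset V) :
    (S - S').card ≤ (S.toFinset.filter (· ∉ S')).card + t := by
  have h1 : S.card ≤ S.toFinset.card + t := by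
    have h2 := hS.card_le le_rfl (Submodule.span F (S.toFinset : Set V))
      (FiniteDimensional.span_finset F _) (fun x hx => Submodule.subset_span (by simpa using hx))
    have h3 := finrank_span_finset_le_card (R := F) S.toFinset
    simp only [Set.finrank] at h3
    omega
  have h2 : (S - S.dedup).card ≤ t := by
    rw [Multiset.card_sub (Multiset.dedup_le S)]
    have : S.toFinset.card = S.dedup.card := rfl
    omega
  have h3 : S - S' ≤ (S.toFinset.filter (· ∉ S')).val + (S - S.dedup) := by
    rw [Multiset.le_iff_count]
    intro x
    rw [Multiset.count_add, Multiset.count_sub, Multiset.count_sub, Multiset.count_dedup,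
      Multiset.count_eq_of_nodup (Finset.nodup _)]
    simp only [Finset.mem_val, Finset.mem_filter, Multiset.mem_toFinset]
    by_cases hx : x ∈ S
    · by_cases hx' : x ∈ S'
      · have := Multiset.count_pos.2 hx'
        simp [hx, hx']; omega
      · simp [hx, hx']; omega
    · simp [hx]
  have h4 := Multiset.card_le_card h3
  rw [Multiset.card_add, Finset.card_val] at h4
  omega

open scoped Classical in
/-- In a minimal vanishing sum of at most `k` products of nearly independent linear forms, any
two products have the same factors up to a bounded number of exceptions. -/
theorem exists_card_sub_bound (k : ℕ) : ∀ t : ℕ, ∃ B : ℕ, ∀ (F : Type u) [Field F] (σ ι : Type)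
    (M : ι → MvPolynomial σ F) (A : Finset ι), A.card ≤ k →
    (∀ i ∈ A, IsLinearProduct t (M i)) → ∑ i ∈ A, M i = 0 →
    (∀ S ⊆ A, S.Nonempty → S ≠ A → ∑ i ∈ S, M i ≠ 0) →
    ∀ i ∈ A, ∀ j ∈ A, (normalizedFactors (M i) - normalizedFactors (M j)).card ≤ B := by
  induction k with
  | zero =>
    refine fun t => ⟨0, fun F _ σ ι M A hA _ _ _ i hi => ?_⟩
    rw [Nat.le_zero, Finset.card_eq_zero] at hA
    simp [hA] at hi
  | succ k ih =>
    intro t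
    obtain ⟨B', hB'⟩ := ih (t + 1)
    -- Large enough for `2 * s + 1 + t < s * s`, as `card_le_of_matchedAlong` requires.
    set s := t + 4 with hs
    set N := s * B' + (s * (s * (B' * (2 + t))) + (2 * s + 1 + t)) + t with hN
    -- More than `X` forms contain `2 * s` independent ones and also exceed the bound of
    -- `card_le_of_dvd_sum`. The factor `2 ^ (k + 1)` below counts the subsets of `A`.
    set X := (k + 1) * N + (s + s + t) with hX
    refine ⟨2 ^ (k + 1) * X + t, fun F _ σ ι M A hA hM hsum hmin i₁ hi₁ j hj => ?_⟩
    by_contra! hcon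
    set T := (normalizedFactors (M i₁)).toFinset.filter (· ∉ normalizedFactors (M j)) with hTdef
    have hTcard : 2 ^ (k + 1) * X < T.card := by
      have : (normalizedFactors (M i₁) - normalizedFactors (M j)).card ≤ T.card + t := by
        convert (hM i₁ hi₁).nearIndep.card_sub_le (normalizedFactors (M j))
      omega
    have hTmem : ∀ ℓ ∈ T, ℓ ∈ normalizedFactors (M i₁) ∧ ℓ ∉ normalizedFactors (M j) :=
      fun ℓ hℓ => by simpa only [hTdef, Finset.mem_filter, Multiset.mem_toFinset] using hℓ
    have hT1 : ∀ ℓ ∈ T, ℓ.totalDegree = 1 := fun ℓ hℓ =>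
      (hM i₁ hi₁).totalDegree_eq ℓ (hTmem ℓ hℓ).1
    have hTn : ∀ ℓ ∈ T, normalize ℓ = ℓ := fun ℓ hℓ =>
      normalize_normalized_factor ℓ (hTmem ℓ hℓ).1
    -- Modulo `ℓ` the product `i₁` vanishes and `j` survives. The survivors contain a minimal
    -- vanishing subsum of at most `k` terms, to which the induction hypothesis applies with defect
    -- `t + 1`.
    have key : ∀ ℓ ∈ T, ∃ φ : MvPolynomial σ F →ₐ[F] MvPolynomial σ F,
        (∀ p, p.totalDegree ≤ 1 → (φ p).totalDegree ≤ 1 ∧ ∃ c : F, p = φ p + c • ℓ) ∧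
        ∃ A' ⊆ A, A'.Nonempty ∧ i₁ ∉ A' ∧ (∀ i ∈ A', ¬ ℓ ∣ M i ∧ φ (M i) ≠ 0) ∧
          ℓ ∣ ∑ i ∈ A', M i ∧ ∀ i ∈ A', ∀ i' ∈ A',
            (normalizedFactors (φ (M i)) - normalizedFactors (φ (M i'))).card ≤ B' := by
      intro ℓ hℓ
      obtain ⟨φ, hφℓ, hφd, hφ⟩ := exists_linear_elimination (hT1 ℓ hℓ)
      have hφ0 : ∀ p, φ p = 0 → ℓ ∣ p := fun p hp => by simpa [hp] using hφd p
      have hφ0' : ∀ p, ℓ ∣ p → φ p = 0 := by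
        rintro p ⟨q, rfl⟩
        rw [map_mul, hφℓ, zero_mul]
      set S := A.filter fun i => φ (M i) ≠ 0 with hS
      have hS0 : ∑ i ∈ S, φ (M i) = 0 := by
        rw [hS, Finset.sum_filter_ne_zero, ← map_sum, hsum, map_zero]
      have hSne : S.Nonempty := ⟨j, Finset.mem_filter.2 ⟨hj, fun h => (hTmem ℓ hℓ).2
        (mem_normalizedFactors_of_dvd (hM j hj).ne_zero (hT1 ℓ hℓ) (hTn ℓ hℓ) (hφ0 _ h))⟩⟩
      obtain ⟨A', hA'S, hA'ne, hA'0, hA'min⟩ := exists_minimal_zero_sum _ S hSne hS0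
      have hA'mem : ∀ i ∈ A', i ∈ A ∧ φ (M i) ≠ 0 := fun i hi => Finset.mem_filter.1 (hA'S hi)
      have hi₁A' : i₁ ∉ A' := fun h => (hA'mem i₁ h).2
        (hφ0' _ (dvd_of_mem_normalizedFactors (hTmem ℓ hℓ).1))
      have hsub : A' ⊆ A := fun i hi => (hA'mem i hi).1
      have hcard : A'.card ≤ k := by
        have : A'.card < A.card := Finset.card_lt_card
          (Finset.ssubset_iff_subset_ne.2 ⟨hsub, fun h => hi₁A' (h ▸ hi₁)⟩)
        omega
      refine ⟨φ, hφ, A', hsub, hA'ne, hi₁A', fun i hi => ⟨fun h => (hA'mem i hi).2 (hφ0' _ h),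
        (hA'mem i hi).2⟩, hφ0 _ (by rw [map_sum, hA'0]), ?_⟩
      exact hB' F σ ι (fun i => φ (M i)) A' hcard
        (fun i hi => (hM i (hsub hi)).map hφ (hA'mem i hi).2) hA'0 hA'min
    choose! φ hφ A' hA'sub hA'ne hi₁A' hA'M hA'dvd hA'B using key
    -- Pigeonhole: more than `X` of the forms lead to the same subsum.
    obtain ⟨A₀, -, hA₀⟩ := Finset.exists_lt_card_fiber_of_mul_lt_card_of_maps_to
      (s := T) (t := A.powerset) (f := A') (n := X)
      (fun ℓ hℓ => Finset.mem_powerset.2 (hA'sub ℓ hℓ)) (by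
        rw [Finset.card_powerset]
        exact lt_of_le_of_lt (Nat.mul_le_mul_right _ (Nat.pow_le_pow_right two_pos hA)) hTcard)
    set T' := T.filter fun ℓ => A' ℓ = A₀ with hT'
    have hT'mem : ∀ ℓ ∈ T', ℓ ∈ T ∧ A' ℓ = A₀ := fun ℓ hℓ => Finset.mem_filter.1 hℓ
    obtain ⟨v, hvli, hvT⟩ := (hM i₁ hi₁).nearIndep.exists_independent (s := s + s) (S := T')
      (fun ℓ hℓ => (hTmem ℓ (hT'mem ℓ hℓ).1).1) (by omega)
    obtain ⟨ℓ₀, hℓ₀⟩ : T'.Nonempty := Finset.card_pos.1 (by omega)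
    obtain ⟨hℓ₀T, rfl⟩ := hT'mem ℓ₀ hℓ₀
    have hvT' : ∀ i, v i ∈ T ∧ A' (v i) = A' ℓ₀ := fun i => hT'mem _ (hvT i)
    have hsplit : Sum.elim (fun i => v (finSumFinEquiv (Sum.inl i)))
        (fun i => v (finSumFinEquiv (Sum.inr i))) = v ∘ finSumFinEquiv := by
      ext1 (i | i) <;> rfl
    have hclose : ∀ i ∈ A' ℓ₀, ∀ i' ∈ A' ℓ₀,
        (normalizedFactors (M i) - normalizedFactors (M i')).card ≤ N := by
      intro i hi i' hi'
      refine card_sub_le_of_many_reductions (hM i (hA'sub _ hℓ₀T hi)) (hM i' (hA'sub _ hℓ₀T hi'))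
        (s := s) (by rw [hs]; nlinarith) (fun i => v (finSumFinEquiv (Sum.inl i)))
        (fun i => v (finSumFinEquiv (Sum.inr i))) ?_ ?_
      · rw [hsplit]
        exact hvli.comp _ finSumFinEquiv.injective
      · rw [hsplit]
        intro x
        obtain ⟨hxT, hxA⟩ := hvT' (finSumFinEquiv x)
        refine ⟨φ (v (finSumFinEquiv x)), hφ _ hxT, ?_, ?_, ?_, ?_⟩
        · exact (hA'M _ hxT i (hxA ▸ hi)).2
        · exact (hA'M _ hxT i' (hxA ▸ hi')).2
        · exact hA'B _ hxT i (hxA ▸ hi) i' (hxA ▸ hi')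
        · exact hA'B _ hxT i' (hxA ▸ hi') i (hxA ▸ hi)
    have hne : A' ℓ₀ ≠ A := fun h => hi₁A' ℓ₀ hℓ₀T (h.symm ▸ hi₁)
    have hlt : (A' ℓ₀).card < A.card := Finset.card_lt_card
      (Finset.ssubset_iff_subset_ne.2 ⟨hA'sub _ hℓ₀T, hne⟩)
    -- The subsum omits `i₁`, so it is non-zero by minimality, yet every form in `T'` divides it.
    have hfew := card_le_of_dvd_sum M (A' ℓ₀) (fun i hi => hM i (hA'sub _ hℓ₀T hi)) hclose
      (hmin _ (hA'sub _ hℓ₀T) (hA'ne _ hℓ₀T) hne) T' (fun ℓ hℓ => by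
        obtain ⟨hℓT, hℓA⟩ := hT'mem ℓ hℓ
        exact ⟨hT1 ℓ hℓT, hTn ℓ hℓT, hℓA ▸ hA'dvd ℓ hℓT, fun i hi => (hA'M ℓ hℓT i (hℓA ▸ hi)).1⟩)
    have : ((A' ℓ₀).card + 1) * N ≤ (k + 1) * N := Nat.mul_le_mul_right _ (by omega)
    omega

end RankBound

/-! ### Spans of the differences between products -/

section DiffSpan

variable {F : Type*} [Field F] {n : ℕ}

open scoped Classical in
/-- The span of the linear forms that occur in one of the given products with a larger
multiplicity than in another one. -/
noncomputable def diffSpan (G : Set (Multiset (Associates (MvPolynomial (Fin n) F)))) :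
    Submodule F (MvPolynomial (Fin n) F) :=
  Submodule.span F {ℓ | ∃ S ∈ G, ∃ T ∈ G, Associates.mk ℓ ∈ S - T}

lemma diffSpan_mono {G H : Set (Multiset (Associates (MvPolynomial (Fin n) F)))} (h : G ⊆ H) :
    diffSpan G ≤ diffSpan H :=
  Submodule.span_mono fun _ ⟨S, hS, T, hT, hℓ⟩ => ⟨S, h hS, T, h hT, hℓ⟩

lemma diffSpan_singleton (S : Multiset (Associates (MvPolynomial (Fin n) F))) :
    diffSpan {S} = ⊥ := by
  rw [diffSpan, Submodule.span_eq_bot]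
  rintro ℓ ⟨S', rfl, T, rfl, h⟩
  simp at h

/-- Whatever `S` has in excess of `T`, either `S` has in excess of the shared member `M` or `M` has
in excess of `T`. -/
lemma diffSpan_union_le {G H : Set (Multiset (Associates (MvPolynomial (Fin n) F)))}
    {M : Multiset (Associates (MvPolynomial (Fin n) F))} (hG : M ∈ G) (hH : M ∈ H) :
    diffSpan (G ∪ H) ≤ diffSpan G ⊔ diffSpan H := by
  classical
  refine Submodule.span_le.2 ?_
  have h1 : ∀ S T : Multiset (Associates (MvPolynomial (Fin n) F)), S ∈ G → T ∈ G → ∀ ℓ,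
      Associates.mk ℓ ∈ S - T → ℓ ∈ diffSpan G ⊔ diffSpan H := fun S T hS hT ℓ h =>
    Submodule.mem_sup_left (Submodule.subset_span ⟨S, hS, T, hT, by convert h⟩)
  have h2 : ∀ S T : Multiset (Associates (MvPolynomial (Fin n) F)), S ∈ H → T ∈ H → ∀ ℓ,
      Associates.mk ℓ ∈ S - T → ℓ ∈ diffSpan G ⊔ diffSpan H := fun S T hS hT ℓ h =>
    Submodule.mem_sup_right (Submodule.subset_span ⟨S, hS, T, hT, by convert h⟩)
  have h3 : ∀ S T : Multiset (Associates (MvPolynomial (Fin n) F)), ∀ x,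
      x ∈ S - T → x ∈ S - M ∨ x ∈ M - T := by
    intro S T x hx
    rw [← Multiset.count_pos, Multiset.count_sub] at hx ⊢
    rw [← Multiset.count_pos, Multiset.count_sub]
    omega
  rintro ℓ ⟨S, hS, T, hT, h⟩
  have h : Associates.mk ℓ ∈ S - T := by convert h
  rcases hS with hS | hS <;> rcases hT with hT | hT
  · exact h1 S T hS hT ℓ h
  · exact (h3 _ _ _ h).elim (h1 _ _ hS hG ℓ) (h2 _ _ hH hT ℓ)
  · exact (h3 _ _ _ h).elim (h2 _ _ hS hH ℓ) (h1 _ _ hG hT ℓ)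
  · exact h2 S T hS hT ℓ h

lemma mem_span_image_out [DecidableEq (MvPolynomial (Fin n) F)]
    {T : Finset (Associates (MvPolynomial (Fin n) F))}
    {ℓ : MvPolynomial (Fin n) F} (h : Associates.mk ℓ ∈ T) :
    ℓ ∈ Submodule.span F ((T.image Quot.out : Finset (MvPolynomial (Fin n) F)) :
      Set (MvPolynomial (Fin n) F)) := by
  have h1 : Associated (Quot.out (Associates.mk ℓ)) ℓ :=
    Associates.mk_eq_mk_iff_associated.1 (Associates.quot_out _)
  obtain ⟨u, -, hu⟩ := exists_smul_of_associated h1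
  rw [hu]
  exact Submodule.smul_mem _ _ (Submodule.subset_span (by
    rw [Finset.mem_coe]; exact Finset.mem_image_of_mem _ h))

open scoped Classical in
lemma finrank_diffSpan_le {G : Set (Multiset (Associates (MvPolynomial (Fin n) F)))}
    (T : Finset (Associates (MvPolynomial (Fin n) F)))
    (h : ∀ S ∈ G, ∀ S' ∈ G, ∀ a ∈ S - S', a ∈ T) :
    FiniteDimensional F (diffSpan G) ∧ Module.finrank F (diffSpan G) ≤ T.card := by
  have hle : diffSpan G ≤ Submodule.span F ((T.image Quot.out : Finset (MvPolynomial (Fin n) F)) :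
      Set (MvPolynomial (Fin n) F)) := by
    refine Submodule.span_le.2 ?_
    rintro ℓ ⟨S, hS, S', hS', hℓ⟩
    exact mem_span_image_out (h S hS S' hS' _ hℓ)
  refine ⟨Submodule.finiteDimensional_of_le hle, (Submodule.finrank_mono hle).trans ?_⟩
  have := finrank_span_finset_le_card (R := F) (T.image Quot.out : Finset (MvPolynomial (Fin n) F))
  exact this.trans Finset.card_image_le

end DiffSpan

/-! ### The syntactic rank as a function of sets of gates -/

section CircuitRank

variable {F : Type*} [Field F] {n : ℕ} {κ : Type*}

/-- The syntactic rank of the gates in `S`. -/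
noncomputable def gateRank (γ : κ → MulGate F n) (S : Set κ) : ℕ :=
  Module.finrank F (diffSpan ((fun i => (γ i).classes) '' S))

lemma finiteDimensional_diffSpan_image (γ : κ → MulGate F n) {S : Set κ} (hS : S.Finite) :
    FiniteDimensional F (diffSpan ((fun i => (γ i).classes) '' S)) := by
  classical
  refine (finrank_diffSpan_le (hS.toFinset.biUnion fun i => (γ i).classes.toFinset) ?_).1
  rintro _ ⟨i, hi, rfl⟩ _ ⟨j, hj, rfl⟩ a ha
  exact Finset.mem_biUnion.2 ⟨i, hS.mem_toFinset.2 hi, Multiset.mem_toFinset.2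
    (Multiset.mem_of_le (Multiset.sub_le_self _ _) ha)⟩

lemma gateRank_mono (γ : κ → MulGate F n) {S T : Set κ} (hT : T.Finite) (h : S ⊆ T) :
    gateRank γ S ≤ gateRank γ T := by
  have := finiteDimensional_diffSpan_image γ hT
  exact Submodule.finrank_mono (diffSpan_mono (Set.image_mono h))

lemma gateRank_of_subsingleton (γ : κ → MulGate F n) {S : Set κ} (hS : S.Subsingleton) :
    gateRank γ S = 0 := by
  have : diffSpan ((fun i => (γ i).classes) '' S) = ⊥ := by
    refine le_bot_iff.1 ?_
    rcases (hS.image (fun i => (γ i).classes)).eq_empty_or_singleton with h | ⟨x, h⟩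
    · exact (diffSpan_mono (h.trans_subset (Set.empty_subset {0}))).trans
        (diffSpan_singleton _).le
    · rw [h, diffSpan_singleton]
  rw [gateRank, this, finrank_bot]

/-- The triangle inequality behind all comparisons of clusters; without a shared gate it fails, as
two single gates show. -/
lemma gateRank_union_le (γ : κ → MulGate F n) {S T : Set κ} (hS : S.Finite) (hT : T.Finite)
    (h : (S ∩ T).Nonempty) : gateRank γ (S ∪ T) ≤ gateRank γ S + gateRank γ T := by
  have := finiteDimensional_diffSpan_image γ hS
  have := finiteDimensional_diffSpan_image γ hT
  obtain ⟨x, hxS, hxT⟩ := h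
  refine le_trans ?_ (Submodule.finrank_add_le_finrank_add_finrank _ _)
  rw [gateRank, Set.image_union]
  exact Submodule.finrank_mono
    (diffSpan_union_le (Set.mem_image_of_mem _ hxS) (Set.mem_image_of_mem _ hxT))

end CircuitRank

/-! ### Syntactic rank and distance without the gcd -/

namespace Circuit

variable {F : Type*} [Field F] {n : ℕ} {ι κ : Type}

open scoped Classical in
lemma le_gcd_iff [Fintype ι] [Nonempty ι] (C : Circuit F n ι)
    (S : Multiset (Associates (MvPolynomial (Fin n) F))) :
    S ≤ C.gcd ↔ ∀ i, S ≤ (C i).classes := by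
  rw [gcd, dif_pos Finset.univ_nonempty]
  simp [Finset.le_inf'_iff]

-- Multiplicities in the gcd are minima over the gates. Hence the syntactic rank depends only on
-- pairwise differences of gates.
open scoped Classical in
lemma mem_classes_sub_gcd [Fintype ι] (C : Circuit F n ι) (i : ι)
    (a : Associates (MvPolynomial (Fin n) F)) :
    a ∈ (C i).classes - C.gcd ↔ ∃ j, a ∈ (C i).classes - (C j).classes := by
  have : Nonempty ι := ⟨i⟩
  simp only [← Multiset.count_pos, Multiset.count_sub]
  constructor
  · intro h
    by_contra! hcon
    have h1 : Multiset.replicate (Multiset.count a (C i).classes) a ≤ C.gcd := by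
      rw [le_gcd_iff]
      intro j
      rw [← Multiset.le_count_iff_replicate_le]
      have := hcon j
      omega
    rw [← Multiset.le_count_iff_replicate_le] at h1
    omega
  · rintro ⟨j, hj⟩
    have h1 := Multiset.count_le_of_le a ((le_gcd_iff C C.gcd).1 le_rfl j)
    omega

lemma synRank_eq_gateRank [Fintype ι] (C : Circuit F n ι) :
    C.synRank = gateRank C Set.univ := by
  classical
  rw [synRank, gateRank, diffSpan]
  refine congrArg (fun s => Module.finrank F (Submodule.span F s)) ?_
  ext ℓ
  simp only [Set.mem_iUnion, residual, Set.mem_ofPred_eq, mem_classes_sub_gcd]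
  simp

lemma synRank_sub (C : Circuit F n ι) (A : Finset ι) :
    (C.sub A).synRank = gateRank C A := by
  rw [synRank_eq_gateRank, gateRank, gateRank]
  refine congrArg (fun s => Module.finrank F (diffSpan s)) ?_
  ext S
  simp [sub]

lemma dist_sub_sub (C : Circuit F n ι) (A B : Finset ι) :
    (C.sub A).dist (C.sub B) = gateRank C (A ∪ B) := by
  rw [dist, synRank_eq_gateRank, gateRank, gateRank]
  refine congrArg (fun s => Module.finrank F (diffSpan s)) ?_
  ext S
  simp only [Set.image_univ, Set.mem_range, Sum.exists, Set.mem_image, Set.mem_union,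
    Finset.mem_coe, add, sub, Sum.elim_inl, Sum.elim_inr, Subtype.exists]
  constructor
  · rintro (⟨i, hi, h⟩ | ⟨i, hi, h⟩)
    · exact ⟨i, Or.inl hi, h⟩
    · exact ⟨i, Or.inr hi, h⟩
  · rintro ⟨i, hi | hi, h⟩
    · exact Or.inl ⟨i, hi, h⟩
    · exact Or.inr ⟨i, hi, h⟩

lemma poly_sub (C : Circuit F n ι) (A : Finset ι) :
    (C.sub A).poly = ∑ i ∈ A, (C i).poly :=
  Finset.sum_coe_sort A fun i => (C i).poly

end Circuit

/-! ### Independence of the factors of a multilinear product -/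

section Multilinear

variable {F : Type*} [Field F] {σ : Type*}

lemma mem_restrictDegree_one_iff {p : MvPolynomial σ F} :
    p ∈ MvPolynomial.restrictDegree σ F 1 ↔ ∀ v, p.degreeOf v ≤ 1 := by
  rw [MvPolynomial.mem_restrictDegree]
  simp only [MvPolynomial.degreeOf_le_iff]
  exact ⟨fun h v d hd => h d hd v, fun h d hd v => h v d hd⟩

lemma mem_restrictDegree_of_dvd {p q : MvPolynomial σ F} (h : p ∣ q) (hq : q ≠ 0)
    (hm : q ∈ MvPolynomial.restrictDegree σ F 1) : p ∈ MvPolynomial.restrictDegree σ F 1 := by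
  rw [mem_restrictDegree_one_iff] at hm ⊢
  obtain ⟨r, rfl⟩ := h
  intro v
  have := hm v
  rw [MvPolynomial.degreeOf_mul_eq (left_ne_zero_of_mul hq) (right_ne_zero_of_mul hq)] at this
  omega

/-- Linear forms in disjoint sets of variables are independent. -/
lemma card_le_finrank_span_of_multilinear (S : Multiset (MvPolynomial σ F))
    (hS : ∀ p ∈ S, p.totalDegree = 1)
    (hm : S.prod ∈ MvPolynomial.restrictDegree σ F 1) :
    FiniteDimensional F (Submodule.span F {p | p ∈ S}) ∧
      S.card ≤ Module.finrank F (Submodule.span F {p | p ∈ S}) := by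
  classical
  induction S using Multiset.induction_on with
  | empty =>
    refine ⟨FiniteDimensional.span_of_finite F (by simp), by simp⟩
  | cons a S ih =>
    have ha := hS a (Multiset.mem_cons_self a S)
    have hS' := fun p hp => hS p (Multiset.mem_cons_of_mem (a := p) hp)
    have h0 : (a ::ₘ S).prod ≠ 0 :=
      Multiset.prod_ne_zero fun h => by simpa using hS 0 h
    rw [Multiset.prod_cons] at hm h0
    obtain ⟨h1, h2⟩ := ih hS' (mem_restrictDegree_of_dvd (dvd_mul_left _ _) h0 hm)
    have hfin : FiniteDimensional F (Submodule.span F {p | p ∈ a ::ₘ S}) :=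
      FiniteDimensional.span_of_finite F (by
        refine ((a ::ₘ S).toFinset.finite_toSet).subset fun x hx => ?_
        simpa using hx)
    refine ⟨hfin, ?_⟩
    rw [Multiset.card_cons]
    refine Nat.succ_le_of_lt (lt_of_le_of_lt h2 (Submodule.finrank_lt_finrank_of_lt ?_))
    obtain ⟨v, hv⟩ := exists_single_of_totalDegree_one ha
    refine lt_of_le_of_ne
      (Submodule.span_mono fun x (hx : x ∈ S) => Multiset.mem_cons_of_mem hx) fun h => ?_
    have haS : a ∈ Submodule.span F {p | p ∈ S} := by
      rw [h]
      exact Submodule.subset_span (Multiset.mem_cons_self a S)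
    -- A variable `v` of `a` occurs in no other factor, since degrees in `v` add up. So the
    -- coefficient of `v` separates `a` from the span of the others.
    have hker : Submodule.span F {p | p ∈ S} ≤
        LinearMap.ker (MvPolynomial.lcoeff F (Finsupp.single v 1)) := by
      refine Submodule.span_le.2 fun p hp => ?_
      have hp : p ∈ S := hp
      change p.coeff (Finsupp.single v 1) = 0
      by_contra hne
      have hda : 1 ≤ a.degreeOf v := by
        have := MvPolynomial.degreeOf_le_iff.1 (le_refl (a.degreeOf v)) _
          (MvPolynomial.mem_support_iff.2 hv)
        simpa using this
      have hdp : 1 ≤ p.degreeOf v := by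
        have := MvPolynomial.degreeOf_le_iff.1 (le_refl (p.degreeOf v)) _
          (MvPolynomial.mem_support_iff.2 hne)
        simpa using this
      have hdvd : a * p ∣ a * S.prod := mul_dvd_mul_left a (Multiset.dvd_prod hp)
      have h3 := mem_restrictDegree_one_iff.1 (mem_restrictDegree_of_dvd hdvd h0 hm) v
      rw [MvPolynomial.degreeOf_mul_eq (left_ne_zero_of_mul h0)
        (fun h => by simpa [h] using hS' p hp)] at h3
      omega
    exact hv (hker haS)

lemma nearIndep_zero_of_multilinear (S : Multiset (MvPolynomial σ F))
    (hS : ∀ p ∈ S, p.totalDegree = 1)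
    (hm : S.prod ∈ MvPolynomial.restrictDegree σ F 1) : NearIndep F 0 S := by
  classical
  intro W hW
  have hle := Multiset.filter_le (· ∈ W) S
  obtain ⟨-, h⟩ := card_le_finrank_span_of_multilinear (S.filter (· ∈ W))
    (fun p hp => hS p (Multiset.mem_of_le hle hp))
    (mem_restrictDegree_of_dvd (Multiset.prod_dvd_prod_of_le hle)
      (Multiset.prod_ne_zero fun h => by simpa using hS 0 h) hm)
  refine h.trans (Submodule.finrank_mono (Submodule.span_le.2 fun p hp => ?_))
  exact (Multiset.mem_filter.1 hp).2

end Multilinear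

/-! ### Irreducible factors of a gate -/

section GateFactors

attribute [local instance] mvPolynomialNormalization

variable {F : Type*} [Field F] {n : ℕ}

lemma MulGate.coeff_ne_zero {M : MulGate F n} (h : M.poly ≠ 0) : M.coeff ≠ 0 := by
  rintro h0
  simp [MulGate.poly, h0] at h

lemma MulGate.associated_prod {M : MulGate F n} (h : M.poly ≠ 0) :
    Associated M.factors.prod M.poly := by
  rw [MulGate.poly, ← MvPolynomial.smul_eq_C_mul]
  exact associated_smul (MulGate.coeff_ne_zero h) _

lemma MulGate.normalizedFactors_poly {M : MulGate F n} (h : M.poly ≠ 0) :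
    normalizedFactors M.poly = M.factors.map normalize := by
  rw [← (MulGate.associated_prod h).normalizedFactors_eq]
  exact normalizedFactors_prod_eq _ fun p hp => irreducible_of_totalDegree_one (M.linear p hp)

lemma MulGate.classes_eq {M : MulGate F n} (h : M.poly ≠ 0) :
    M.classes = (normalizedFactors M.poly).map Associates.mk := by
  rw [MulGate.normalizedFactors_poly h, Multiset.map_map, MulGate.classes]
  refine Multiset.map_congr rfl fun p _ => ?_
  exact Associates.mk_eq_mk_iff_associated.2 (normalize_associated p).symm

lemma MulGate.isLinearProduct {M : MulGate F n} (h : M.poly ≠ 0)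
    (hm : M.poly ∈ MvPolynomial.restrictDegree (Fin n) F 1) : IsLinearProduct 0 M.poly := by
  have h1 : ∀ p ∈ normalizedFactors M.poly, p.totalDegree = 1 := by
    intro p hp
    rw [MulGate.normalizedFactors_poly h, Multiset.mem_map] at hp
    obtain ⟨q, hq, rfl⟩ := hp
    rw [totalDegree_normalize, M.linear q hq]
  exact ⟨h, h1, nearIndep_zero_of_multilinear _ h1
    (mem_restrictDegree_of_dvd (prod_normalizedFactors h).dvd h hm)⟩

open scoped Classical in
lemma card_classes_sub_le {M N : MulGate F n} (hM : M.poly ≠ 0) (hN : N.poly ≠ 0) :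
    (M.classes - N.classes).card ≤
      (normalizedFactors M.poly - normalizedFactors N.poly).card := by
  rw [MulGate.classes_eq hM, MulGate.classes_eq hN, ← Multiset.card_map Associates.mk
    (normalizedFactors M.poly - normalizedFactors N.poly)]
  refine Multiset.card_le_card (tsub_le_iff_right.2 ?_)
  rw [← Multiset.map_add]
  exact Multiset.map_le_map le_tsub_add

end GateFactors

/-! ### Finiteness of R_M -/

section RankBound

attribute [local instance] mvPolynomialNormalization

open scoped Classical in
/-- The ranks of minimal vanishing multilinear circuits with a bounded number of gates are
bounded, uniformly in the field and in the number of variables. -/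
theorem exists_synRank_bound (k : ℕ) : ∃ B : ℕ, ∀ (F : Type u) [Field F] (n m : ℕ)
    (C : Circuit F n (Fin m)), m ≤ k → C.IsMultilinear → C.IsMinimal → C.poly = 0 →
      C.synRank ≤ B := by
  obtain ⟨B, hB⟩ := exists_card_sub_bound.{u} k 0
  refine ⟨k * (k * B), fun F _ n m C hm hmul hmin h0 => ?_⟩
  rw [Circuit.synRank_eq_gateRank]
  -- Minimality concerns proper subsets only, so a lone gate may compute zero; its rank is zero in
  -- any case.
  rcases Nat.lt_or_ge m 2 with hm2 | hm2
  · have : Subsingleton (Fin m) := Fin.subsingleton_iff_le_one.2 (by omega)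
    rw [gateRank_of_subsingleton C Set.subsingleton_univ]
    exact Nat.zero_le _
  have hne : ∀ i, (C i).poly ≠ 0 := by
    intro i
    have := hmin {i} (Finset.singleton_nonempty i) (fun h => by
      have := congrArg Finset.card h
      simp at this
      omega)
    simpa using this
  have hlp : ∀ i, IsLinearProduct 0 (C i).poly := fun i => MulGate.isLinearProduct (hne i) (hmul i)
  have key := hB F (Fin n) (Fin m) (fun i => (C i).poly) Finset.univ (by simpa using hm)
    (fun i _ => hlp i) h0 (fun S _ => hmin S)
  refine (finrank_diffSpan_le (Finset.univ.biUnion fun i => Finset.univ.biUnion fun j =>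
    ((C i).classes - (C j).classes).toFinset) ?_).2.trans ?_
  · rintro _ ⟨i, -, rfl⟩ _ ⟨j, -, rfl⟩ a ha
    simp only [Finset.mem_biUnion, Finset.mem_univ, true_and, Multiset.mem_toFinset]
    exact ⟨i, j, ha⟩
  · refine (Finset.card_biUnion_le_card_mul _ _ (k * B) fun i _ => ?_).trans
      (Nat.mul_le_mul_right _ (by simpa using hm))
    refine (Finset.card_biUnion_le_card_mul _ _ B fun j _ => ?_).trans
      (Nat.mul_le_mul_right _ (by simpa using hm))
    refine (Multiset.toFinset_card_le _).trans ((card_classes_sub_le (hne i) (hne j)).trans ?_)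
    refine le_of_eq_of_le ?_ (key i (Finset.mem_univ i) j (Finset.mem_univ j))
    congr!

/-- The supremum of an unbounded set of naturals is `0` by convention, so this inequality depends on
the uniform bound. -/
lemma synRank_le_rankBoundML {k : ℕ} {F : Type u} [Field F] {n m : ℕ} (C : Circuit F n (Fin m))
    (hm : m ≤ k) (hmul : C.IsMultilinear) (hs : C.IsSimple) (hmin : C.IsMinimal)
    (h0 : C.poly = 0) : C.synRank ≤ rankBoundML.{u} k := by
  obtain ⟨B, hB⟩ := exists_synRank_bound.{u} k
  refine le_csSup ⟨B, ?_⟩ ⟨F, inferInstance, n, m, C, hm, hmul, hs, hmin, h0, rfl⟩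
  rintro r ⟨F', _, n', m', C', hm', hmul', -, hmin', h0', rfl⟩
  exact hB F' n' m' C' hm' hmul' hmin' h0'

end RankBound

/-! ### Dividing out the gcd of a set of gates -/

section Simplification

/-- A representative of a class of associated elements. -/
noncomputable def classRep {M : Type*} [Monoid M] (a : Associates M) : M := Quot.out a

lemma mk_classRep {M : Type*} [Monoid M] (a : Associates M) : Associates.mk (classRep a) = a :=
  Associates.quot_out a

lemma associated_prod_classRep {M : Type*} [CommMonoid M] (S : Multiset M) :
    Associated S.prod ((S.map Associates.mk).map classRep).prod := by
  rw [← Associates.mk_eq_mk_iff_associated, ← Associates.prod_mk, ← Associates.prod_mk,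
    Multiset.map_map Associates.mk classRep]
  simp only [Function.comp_def, mk_classRep, Multiset.map_id']

variable {F : Type*} [Field F] {n : ℕ} {κ : Type*}

lemma MulGate.totalDegree_classRep {M : MulGate F n} {a : Associates (MvPolynomial (Fin n) F)}
    (ha : a ∈ M.classes) : (classRep a).totalDegree = 1 := by
  obtain ⟨p, hp, rfl⟩ := Multiset.mem_map.1 ha
  rw [totalDegree_eq_of_associated (Associates.mk_eq_mk_iff_associated.1 (mk_classRep (Associates.mk p))), M.linear p hp]

open scoped Classical in
lemma MulGate.exists_eq_mul_prod_classRep (M : MulGate F n)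
    (g : Multiset (Associates (MvPolynomial (Fin n) F))) (hg : g ≤ M.classes) :
    ∃ N : MulGate F n, N.classes = M.classes - g ∧ M.poly = N.poly * (g.map classRep).prod := by
  obtain ⟨u, hu, h⟩ := exists_smul_of_associated (associated_prod_classRep M.factors).symm
  refine ⟨⟨M.coeff * u, (M.classes - g).map classRep, ?_⟩, ?_, ?_⟩
  · intro ℓ hℓ
    obtain ⟨a, ha, rfl⟩ := Multiset.mem_map.1 hℓ
    exact MulGate.totalDegree_classRep (Multiset.mem_of_le (Multiset.sub_le_self _ _) ha)
  · rw [MulGate.classes, Multiset.map_map]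
    simp only [Function.comp_def, mk_classRep, Multiset.map_id']
  · simp only [MulGate.poly]
    rw [mul_assoc, ← Multiset.prod_add, ← Multiset.map_add, tsub_add_cancel_of_le hg, h,
      MvPolynomial.smul_eq_C_mul, map_mul, MulGate.classes, mul_assoc]

lemma MulGate.prod_classRep_ne_zero {M : MulGate F n}
    {g : Multiset (Associates (MvPolynomial (Fin n) F))} (hg : g ≤ M.classes) :
    (g.map classRep).prod ≠ 0 := by
  refine Multiset.prod_ne_zero fun h => ?_
  obtain ⟨a, ha, h0⟩ := Multiset.mem_map.1 h
  have := MulGate.totalDegree_classRep (Multiset.mem_of_le hg ha)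
  simp [h0] at this

/-- A minimal vanishing sum of at most `k` multilinear gates has rank at most `R_M(k)`. -/
lemma gateRank_le_rankBoundML {F : Type u} [Field F] {n k : ℕ} {κ : Type*} (γ : κ → MulGate F n)
    (E : Finset κ) (hE : E.card ≤ k)
    (hmul : ∀ i ∈ E, (γ i).poly ∈ MvPolynomial.restrictDegree (Fin n) F 1)
    (h0 : ∑ i ∈ E, (γ i).poly = 0)
    (hmin : ∀ S ⊆ E, S.Nonempty → S ≠ E → ∑ i ∈ S, (γ i).poly ≠ 0) :
    gateRank γ (E : Set κ) ≤ rankBoundML.{u} k := by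
  classical
  rcases Nat.lt_or_ge E.card 2 with hlt | hge
  · rw [gateRank_of_subsingleton γ (Finset.card_le_one_iff_subsingleton.1 (by omega))]
    exact Nat.zero_le _
  have hEne : E.Nonempty := Finset.card_pos.1 (by omega)
  have hne : ∀ i ∈ E, (γ i).poly ≠ 0 := by
    intro i hi
    have := hmin {i} (by simpa using hi) (Finset.singleton_nonempty i) (by
      rintro rfl
      simp at hge)
    simpa using this
  set g := E.inf' hEne fun i => (γ i).classes with hg
  have hgle : ∀ i ∈ E, g ≤ (γ i).classes := fun i hi => Finset.inf'_le _ hi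
  set h := (g.map classRep).prod with hh
  have hh0 : h ≠ 0 := MulGate.prod_classRep_ne_zero (hgle _ hEne.choose_spec)
  have hN : ∀ i ∈ E, ∃ N : MulGate F n, N.classes = (γ i).classes - g ∧
      (γ i).poly = N.poly * h := by
    intro i hi
    obtain ⟨N, hN1, hN2⟩ := MulGate.exists_eq_mul_prod_classRep (γ i) g (hgle i hi)
    exact ⟨N, by convert hN1, hN2⟩
  have : Nonempty (MulGate F n) := ⟨γ hEne.choose⟩
  choose! N hNc hNp using hN
  set e : Fin E.card ≃ E := E.equivFin.symm with he
  set C : Circuit F n (Fin E.card) := fun x => N (e x) with hC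
  have hsum : ∀ S : Finset (Fin E.card),
      ∑ i ∈ S.map (e.toEmbedding.trans (Function.Embedding.subtype _)), (γ i).poly =
        (∑ x ∈ S, (C x).poly) * h := by
    intro S
    rw [Finset.sum_map, Finset.sum_mul]
    exact Finset.sum_congr rfl fun x _ => hNp _ (e x).2
  have huniv : (Finset.univ : Finset (Fin E.card)).map
      (e.toEmbedding.trans (Function.Embedding.subtype _)) = E := by
    ext i
    simp only [Finset.mem_map, Finset.mem_univ, true_and]
    constructor
    · rintro ⟨x, rfl⟩
      exact (e x).2
    · intro hi
      exact ⟨e.symm ⟨i, hi⟩, by simp⟩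
  have hCne : Nonempty (Fin E.card) := ⟨⟨0, by omega⟩⟩
  -- Removing the common multiset `g` from all gates leaves their pairwise differences unchanged.
  have hrank : C.synRank = gateRank γ (E : Set κ) := by
    rw [Circuit.synRank_eq_gateRank, gateRank, gateRank, diffSpan, diffSpan]
    refine congrArg (fun s => Module.finrank F (Submodule.span F s)) ?_
    ext ℓ
    constructor
    · rintro ⟨_, ⟨x, -, rfl⟩, _, ⟨y, -, rfl⟩, hxy⟩
      refine ⟨_, ⟨e x, (e x).2, rfl⟩, _, ⟨e y, (e y).2, rfl⟩, ?_⟩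
      simp only [hC, hNc _ (e x).2, hNc _ (e y).2] at hxy
      rw [← Multiset.count_pos] at hxy ⊢
      simp only [Multiset.count_sub] at hxy ⊢
      omega
    · rintro ⟨_, ⟨i, hi, rfl⟩, _, ⟨j, hj, rfl⟩, hij⟩
      refine ⟨_, ⟨e.symm ⟨i, hi⟩, trivial, rfl⟩, _, ⟨e.symm ⟨j, hj⟩, trivial, rfl⟩, ?_⟩
      simp only [hC, Equiv.apply_symm_apply, hNc _ hi, hNc _ hj]
      have hc := Multiset.count_le_of_le (Associates.mk ℓ) (hgle j hj)
      rw [← Multiset.count_pos] at hij ⊢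
      simp only [Multiset.count_sub] at hij ⊢
      omega
  rw [← hrank]
  refine synRank_le_rankBoundML C hE ?_ ?_ ?_ ?_
  · intro x
    exact mem_restrictDegree_of_dvd (Dvd.intro _ (hNp _ (e x).2).symm) (hne _ (e x).2)
      (hmul _ (e x).2)
  -- A form common to all quotients could be added to `g`, which is already the largest common part.
  · refine Multiset.eq_zero_of_forall_notMem fun a ha => ?_
    have h1 : g + {a} ≤ g := by
      refine Finset.le_inf' _ _ fun i hi => ?_
      have h2 : a ∈ (C (e.symm ⟨i, hi⟩)).classes :=
        Multiset.mem_of_le ((Circuit.le_gcd_iff C C.gcd).1 le_rfl _) ha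
      simp only [hC, Equiv.apply_symm_apply, hNc _ hi] at h2
      rw [← tsub_add_cancel_of_le (hgle i hi), add_comm]
      exact add_le_add_left (Multiset.singleton_le.2 h2) _
    have := Multiset.card_le_card h1
    simp at this
  · intro S hS hSne h1
    refine hmin (S.map (e.toEmbedding.trans (Function.Embedding.subtype _)))
      (fun i hi => ?_) (hS.map) (fun h2 => hSne ?_) (by rw [hsum, h1, zero_mul])
    · rw [← huniv]
      exact Finset.map_subset_map.2 (Finset.subset_univ S) hi
    · exact Finset.map_injective _ (h2.trans huniv.symm)
  · have h1 := hsum Finset.univ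
    rw [huniv, h0] at h1
    exact (mul_eq_zero.1 h1.symm).resolve_right hh0

end Simplification

/-! ### Positivity of R_M -/

section LowerBound

/-- The identity `x + 1 - (x + 1) = 0` is a simple and minimal circuit with three gates. -/
lemma one_le_rankBoundML (F : Type u) [Field F] {k : ℕ} (hk : 3 ≤ k) : 1 ≤ rankBoundML.{u} k := by
  classical
  have hX : (MvPolynomial.X 0 : MvPolynomial (Fin 1) F).totalDegree = 1 :=
    MvPolynomial.totalDegree_X _
  have hX1 : (MvPolynomial.X 0 + 1 : MvPolynomial (Fin 1) F).totalDegree = 1 := by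
    rw [← MvPolynomial.C_1, MvPolynomial.totalDegree_add_eq_left_of_totalDegree_lt] <;> simp
  set C : Circuit F 1 (Fin 3) := ![⟨1, {MvPolynomial.X 0}, by simp⟩, ⟨1, 0, by simp⟩,
    ⟨-1, {MvPolynomial.X 0 + 1}, by simpa using hX1⟩] with hC
  have p0 : (C 0).poly = MvPolynomial.X 0 := by simp [hC, MulGate.poly]
  have p1 : (C 1).poly = 1 := by simp [hC, MulGate.poly]
  have p2 : (C 2).poly = -(MvPolynomial.X 0 + 1) := by simp [hC, MulGate.poly]
  have hXne : (MvPolynomial.X 0 : MvPolynomial (Fin 1) F) ≠ 0 := MvPolynomial.X_ne_zero 0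
  have hX1ne : (MvPolynomial.X 0 + 1 : MvPolynomial (Fin 1) F) ≠ 0 := by
    intro h; simp [h] at hX1
  have hcl : (C 1).classes = 0 := by simp [hC, MulGate.classes]
  have hgcd : C.gcd = 0 := by
    have := (Circuit.le_gcd_iff C C.gcd).1 le_rfl 1
    rw [hcl] at this
    exact Multiset.le_zero.1 this
  have hr : C.synRank ≤ rankBoundML.{u} k := by
    refine synRank_le_rankBoundML C hk ?_ hgcd ?_ ?_
    · intro i
      rw [mem_restrictDegree_one_iff]
      intro v
      refine (MvPolynomial.degreeOf_le_totalDegree _ v).trans ?_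
      fin_cases i
      · exact (congrArg _ p0).trans_le hX.le
      · exact (congrArg _ p1).trans_le (by simp)
      · exact (congrArg _ p2).trans_le (by rw [MvPolynomial.totalDegree_neg]; exact hX1.le)
    · intro S hS hSu
      have h3 : ∀ S : Finset (Fin 3), S.Nonempty → S ≠ Finset.univ → S = {0} ∨ S = {1} ∨ S = {2} ∨
        S = {0, 1} ∨ S = {0, 2} ∨ S = {1, 2} := by decide
      have h4 : (1 : MvPolynomial (Fin 1) F) ≠ 0 := one_ne_zero
      rcases h3 S hS hSu with rfl | rfl | rfl | rfl | rfl | rfl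
      · rwa [Finset.sum_singleton, p0]
      · rwa [Finset.sum_singleton, p1]
      · rw [Finset.sum_singleton, p2]
        exact neg_ne_zero.2 hX1ne
      · rwa [Finset.sum_pair (by decide), p0, p1]
      · rw [Finset.sum_pair (by decide), p0, p2, neg_add, add_neg_cancel_left]
        exact neg_ne_zero.2 h4
      · rw [Finset.sum_pair (by decide), p1, p2, neg_add, add_comm, neg_add_cancel_right]
        exact neg_ne_zero.2 hXne
    · rw [Circuit.poly, Fin.sum_univ_three, p0, p1, p2, add_neg_cancel]
  refine le_trans ?_ hr
  rw [Circuit.synRank_eq_gateRank, gateRank]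
  have hfin := finiteDimensional_diffSpan_image C (S := Set.univ) Set.finite_univ
  rw [Nat.one_le_iff_ne_zero]
  intro h0
  rw [Submodule.finrank_eq_zero] at h0
  have : (MvPolynomial.X 0 : MvPolynomial (Fin 1) F) ∈
      diffSpan ((fun i => (C i).classes) '' Set.univ) := by
    refine Submodule.subset_span ⟨_, ⟨0, trivial, rfl⟩, _, ⟨1, trivial, rfl⟩, ?_⟩
    simp only [hcl, tsub_zero]
    simp [hC, MulGate.classes]
  rw [h0] at this
  exact hXne ((Submodule.mem_bot F).1 this)

end LowerBound

/-! ### Partitions into minimal vanishing sums -/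

section ZeroSumPartition

variable {κ A : Type*} [DecidableEq κ] [AddCommGroup A]

lemma exists_finpartition_minimal_zero_sum (g : κ → A) (S : Finset κ) (h0 : ∑ i ∈ S, g i = 0) :
    ∃ Z : Finpartition S, ∀ E ∈ Z.parts, ∑ i ∈ E, g i = 0 ∧
      ∀ U ⊆ E, U.Nonempty → U ≠ E → ∑ i ∈ U, g i ≠ 0 := by
  induction S using Finset.strongInduction with
  | H S ih =>
    rcases S.eq_empty_or_nonempty with rfl | hS
    · exact ⟨Finpartition.empty _, fun E hE => by simp at hE⟩
    · obtain ⟨T, hTS, hT, hT0, hTmin⟩ := exists_minimal_zero_sum g S hS h0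
      obtain ⟨Z, hZ⟩ := ih (S \ T) (Finset.sdiff_ssubset hTS hT) (by
        have := Finset.sum_sdiff hTS (f := g)
        rwa [hT0, h0, add_zero] at this)
      refine ⟨Z.extend (b := T) hT.ne_empty Finset.sdiff_disjoint
        (Finset.sdiff_union_of_subset hTS), fun E hE => ?_⟩
      rcases Finset.mem_insert.1 hE with rfl | hE
      · exact ⟨hT0, hTmin⟩
      · exact hZ E hE

/-- Each fibre of `h` is a union of parts, as `h` is constant on every part. -/
lemma sum_filter_eq_zero_of_finpartition {β : Type*} [DecidableEq β] (g : κ → A) {S : Finset κ}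
    (Z : Finpartition S) (hZ : ∀ E ∈ Z.parts, ∑ i ∈ E, g i = 0) (h : κ → β)
    (hh : ∀ E ∈ Z.parts, ∀ x ∈ E, ∀ y ∈ E, h x = h y) (b : β) :
    ∑ x ∈ S.filter (h · = b), g x = 0 := by
  rw [Finset.sum_filter]
  conv_lhs => rw [← Z.biUnion_parts]
  rw [Finset.sum_biUnion Z.disjoint]
  refine Finset.sum_eq_zero fun E hE => ?_
  obtain ⟨x, hx⟩ := Z.nonempty_of_mem_parts hE
  by_cases hb : h x = b
  · rw [← hZ E hE]
    exact Finset.sum_congr rfl fun y hy => if_pos ((hh E hE y hy x hx).trans hb)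
  · exact Finset.sum_eq_zero fun y hy => if_neg fun hy' => hb ((hh E hE x hx y hy).trans hy')

end ZeroSumPartition

/-! ### Rank growth and merging of clusters -/

section Merging

variable {F : Type*} [Field F] {n : ℕ} {κ : Type*}

lemma gateRank_image {κ' : Type*} (γ : κ' → MulGate F n) (e : κ → κ') (S : Set κ) :
    gateRank γ (e '' S) = gateRank (γ ∘ e) S := by
  rw [gateRank, gateRank, Set.image_image]
  rfl

lemma gateRank_union_biUnion_le [DecidableEq κ] {ι : Type*} (γ : κ → MulGate F n) (A : Finset κ)
    (E : ι → Finset κ) (J : Finset ι) {R : ℕ} (hE : ∀ j ∈ J, gateRank γ (E j : Set κ) ≤ R)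
    (hA : ∀ j ∈ J, (E j ∩ A).Nonempty) :
    gateRank γ ((A ∪ J.biUnion E : Finset κ) : Set κ) ≤ gateRank γ (A : Set κ) + J.card * R := by
  classical
  induction J using Finset.induction_on with
  | empty => simp
  | insert j J hj ih =>
    have h1 := ih (fun i hi => hE i (Finset.mem_insert_of_mem hi))
      (fun i hi => hA i (Finset.mem_insert_of_mem hi))
    have h2 : A ∪ (insert j J).biUnion E = (A ∪ J.biUnion E) ∪ E j := by
      rw [Finset.biUnion_insert, Finset.union_comm (E j), Finset.union_assoc]
    obtain ⟨x, hx⟩ := hA j (Finset.mem_insert_self j J)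
    have h3 := gateRank_union_le γ (A ∪ J.biUnion E : Finset κ).finite_toSet (E j).finite_toSet
      ⟨x, by simpa using Or.inl (Finset.mem_inter.1 hx).2, (Finset.mem_inter.1 hx).1⟩
    have h4 := hE j (Finset.mem_insert_self j J)
    rw [h2, Finset.card_insert_of_notMem hj, Finset.coe_union, add_mul, one_mul]
    omega

lemma exists_finpartition_merge [DecidableEq κ] {S : Finset κ} (P : Finpartition S)
    {A B : Finset κ} (hA : A ∈ P.parts) (hB : B ∈ P.parts) (hAB : A ≠ B) :
    ∃ P' : Finpartition S, P'.parts.card < P.parts.card ∧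
      ∀ X ∈ P'.parts, X = A ∪ B ∨ X ∈ P.parts := by
  have hsub : A ∪ B ⊆ S := Finset.union_subset (P.subset hA) (P.subset hB)
  have hne : A ∪ B ≠ ∅ := by
    obtain ⟨x, hx⟩ := P.nonempty_of_mem_parts hA
    exact Finset.nonempty_iff_ne_empty.1 ⟨x, Finset.mem_union_left _ hx⟩
  have hav : (P.avoid (A ∪ B)).parts ⊆ (P.parts.erase A).erase B := by
    intro X hX
    obtain ⟨d, hd, hdAB, rfl⟩ := P.mem_avoid.1 hX
    have hdA : d ≠ A := fun h => hdAB (h ▸ Finset.subset_union_left)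
    have hdB : d ≠ B := fun h => hdAB (h ▸ Finset.subset_union_right)
    have hdisj : Disjoint d (A ∪ B) :=
      Finset.disjoint_union_right.2 ⟨P.disjoint hd hA hdA, P.disjoint hd hB hdB⟩
    rw [Finset.sdiff_eq_self_of_disjoint hdisj]
    exact Finset.mem_erase.2 ⟨hdB, Finset.mem_erase.2 ⟨hdA, hd⟩⟩
  refine ⟨(P.avoid (A ∪ B)).extend (b := A ∪ B) hne Finset.sdiff_disjoint
    (Finset.sdiff_union_of_subset hsub), ?_, ?_⟩
  · rw [Finpartition.card_extend]
    have h1 := Finset.card_le_card hav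
    rw [Finset.card_erase_of_mem (Finset.mem_erase.2 ⟨hAB.symm, hB⟩),
      Finset.card_erase_of_mem hA] at h1
    have h2 : 1 < P.parts.card := Finset.one_lt_card.2 ⟨A, hA, B, hB, hAB⟩
    omega
  · intro X hX
    rcases Finset.mem_insert.1 hX with rfl | hX
    · exact Or.inl rfl
    · exact Or.inr (Finset.mem_of_mem_erase (Finset.mem_of_mem_erase (hav hX)))

end Merging

/-! ### Size of r in a clustering, and common pieces of two circuits -/

section Clustering

variable {F : Type u} [Field F] {n : ℕ} {ι κ : Type} [Fintype ι] [DecidableEq ι] [Fintype κ]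
  [DecidableEq κ]

lemma Circuit.isSynPartition_iff (C : Circuit F n ι) (P : Finpartition (Finset.univ : Finset ι))
    (τ r : ℕ) : C.IsSynPartition P τ r ↔ (∀ A ∈ P.parts, gateRank C (A : Set ι) ≤ r) ∧
      ∀ A ∈ P.parts, ∀ B ∈ P.parts, A ≠ B → τ * r ≤ gateRank C ((A : Set ι) ∪ B) := by
  simp only [Circuit.IsSynPartition, Circuit.synRank_sub, Circuit.dist_sub_sub]

/-- Merging close clusters leads to a syntactic partition. -/
lemma Circuit.exists_isSynPartition (C : Circuit F n ι) [Nonempty ι] {τ : ℕ} (hτ : 1 ≤ τ) (R : ℕ) :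
    ∃ (P : Finpartition (Finset.univ : Finset ι)) (r : ℕ), R ≤ r ∧
      r ≤ τ ^ (Fintype.card ι - 1) * R ∧ C.IsSynPartition P τ r := by
  -- The bound on the ranks gains a factor `τ` per merge: if the clusters are not yet separated, two
  -- close ones have a union of rank below `τ` times the current bound. The process starts from
  -- singletons, of rank zero.
  have key : ∀ c : ℕ, ∀ P : Finpartition (Finset.univ : Finset ι), P.parts.card = c →
      (∀ A ∈ P.parts, gateRank C (A : Set ι) ≤ τ ^ (Fintype.card ι - c) * R) →
      ∃ (P : Finpartition (Finset.univ : Finset ι)) (r : ℕ), R ≤ r ∧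
        r ≤ τ ^ (Fintype.card ι - 1) * R ∧ C.IsSynPartition P τ r := by
    intro c
    induction c using Nat.strong_induction_on with
    | _ c ih =>
      intro P hc hP
      have hcι : c ≤ Fintype.card ι := hc ▸ P.card_parts_le_card
      have hc1 : 1 ≤ c := hc ▸ Finset.card_pos.2
        (P.parts_nonempty (Finset.nonempty_iff_ne_empty.1 Finset.univ_nonempty))
      by_cases h : C.IsSynPartition P τ (τ ^ (Fintype.card ι - c) * R)
      · refine ⟨P, _, Nat.le_mul_of_pos_left _ (Nat.pow_pos hτ), ?_, h⟩
        exact Nat.mul_le_mul_right _ (Nat.pow_le_pow_right hτ (by omega))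
      · rw [Circuit.isSynPartition_iff] at h
        push Not at h
        obtain ⟨A, hA, B, hB, hAB, hlt⟩ := h hP
        obtain ⟨P', hcard, hP'⟩ := exists_finpartition_merge P hA hB hAB
        refine ih P'.parts.card (hc ▸ hcard) P' rfl fun X hX => ?_
        rcases hP' X hX with rfl | hX
        · rw [Finset.coe_union]
          refine hlt.le.trans ?_
          rw [← mul_assoc, ← pow_succ']
          exact Nat.mul_le_mul_right _ (Nat.pow_le_pow_right hτ (by omega))
        · exact (hP X hX).trans
            (Nat.mul_le_mul_right _ (Nat.pow_le_pow_right hτ (by omega)))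
  refine key _ ⊥ rfl fun A hA => ?_
  obtain ⟨a, -, rfl⟩ := Finpartition.mem_bot_iff.1 hA
  rw [gateRank_of_subsingleton C (by simp)]
  exact Nat.zero_le _

/-- A lowest `r` is at most the value reached by merging; the exponent `k - 1` covers both
admissible guarantees. -/
lemma IsClusteringOutput.exists_isSynPartition {C : Circuit F n ι} [Nonempty ι] {k τ : ℕ}
    {P : Finpartition (Finset.univ : Finset ι)} (h : IsClusteringOutput k τ C P)
    (hk : Fintype.card ι ≤ k) (hτ : 1 ≤ τ) :
    ∃ r, rankBoundML.{u} (2 * k) ≤ r ∧ r ≤ (k * τ) ^ (k - 1) * rankBoundML.{u} (2 * k) ∧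
      C.IsSynPartition P τ r := by
  have hι : 0 < Fintype.card ι := Fintype.card_pos
  have hkτ : τ ≤ k * τ := Nat.le_mul_of_pos_left _ (by omega)
  obtain ⟨r, hr, hP, hr' | hr'⟩ := h
  · refine ⟨r, hr, hr'.trans (Nat.mul_le_mul_right _ (Nat.pow_le_pow_right (by omega) ?_)), hP⟩
    omega
  · obtain ⟨P', r', h1, h2, h3⟩ := C.exists_isSynPartition hτ (rankBoundML.{u} (2 * k))
    refine ⟨r, hr, (hr' P' r' h1 h3).trans (h2.trans (Nat.mul_le_mul_right _ ?_)), hP⟩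
    exact (Nat.pow_le_pow_left hkτ _).trans (Nat.pow_le_pow_right (by omega) (by omega))

/-- Two minimal circuits for the same non-zero polynomial decompose into pieces of small rank that
compute the same polynomials. -/
lemma exists_common_pieces {C : Circuit F n ι} {D : Circuit F n κ} {k : ℕ}
    (hι : Fintype.card ι ≤ k) (hκ : Fintype.card κ ≤ k)
    (hCm : C.IsMultilinear) (hDm : D.IsMultilinear) (hC : C.IsMinimal) (hD : D.IsMinimal)
    (hCD : C.poly = D.poly) (h0 : C.poly ≠ 0) :
    ∃ Z : Finpartition (Finset.univ : Finset (ι ⊕ κ)), ∀ E ∈ Z.parts,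
      (∃ i, Sum.inl i ∈ E) ∧ (∃ j, Sum.inr j ∈ E) ∧
      ∑ x ∈ E, Sum.elim (fun i => (C i).poly) (fun j => -(D j).poly) x = 0 ∧
      gateRank (C.add D) (E : Set (ι ⊕ κ)) ≤ rankBoundML.{u} (2 * k) := by
  have hnz : ∀ {ι : Type} [Fintype ι] (C : Circuit F n ι), C.IsMinimal → C.poly ≠ 0 →
      ∀ S : Finset ι, S.Nonempty → ∑ i ∈ S, (C i).poly ≠ 0 := by
    intro ι _ C hC h0 S hS
    by_cases h : S = Finset.univ
    · exact h ▸ h0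
    · exact hC S hS h
  set g : ι ⊕ κ → MvPolynomial (Fin n) F :=
    Sum.elim (fun i => (C i).poly) (fun j => -(D j).poly) with hg
  -- The gates of `D` are negated so that everything sums to zero. Signs do not affect the linear
  -- factors, hence not the rank.
  set γ : ι ⊕ κ → MulGate F n :=
    Sum.elim C fun j => ⟨-(D j).coeff, (D j).factors, (D j).linear⟩ with hγ
  have hγg : ∀ x, (γ x).poly = g x := by
    rintro (i | j)
    · rfl
    · simp [hγ, hg, MulGate.poly]
  have hγrank : ∀ S, gateRank γ S = gateRank (C.add D) S := by
    intro S
    have : (fun x => (γ x).classes) = fun x => (C.add D x).classes := by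
      ext1 (i | j) <;> rfl
    rw [gateRank, gateRank, this]
  obtain ⟨Z, hZ⟩ := exists_finpartition_minimal_zero_sum g Finset.univ (by
    rw [Fintype.sum_sum_type]
    simp only [hg, Sum.elim_inl, Sum.elim_inr, Finset.sum_neg_distrib]
    exact add_neg_eq_zero.2 hCD)
  refine ⟨Z, fun E hE => ?_⟩
  obtain ⟨hE0, hEmin⟩ := hZ E hE
  have hEne := Z.nonempty_of_mem_parts hE
  refine ⟨?_, ?_, hE0, ?_⟩
  -- A piece without gates of `C` would be a non-empty vanishing subsum of `D`, contrary to
  -- minimality and `D.poly ≠ 0`.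
  · by_contra! hcon
    have hEeq : E = E.toRight.map Function.Embedding.inr := by
      ext (i | j) <;> simp [hcon]
    rw [hEeq, Finset.sum_map] at hE0
    simp only [hg, Function.Embedding.inr_apply, Sum.elim_inr, Finset.sum_neg_distrib,
      neg_eq_zero] at hE0
    refine hnz D hD (hCD ▸ h0) E.toRight ?_ hE0
    rw [hEeq] at hEne
    exact Finset.map_nonempty.1 hEne
  · by_contra! hcon
    have hEeq : E = E.toLeft.map Function.Embedding.inl := by
      ext (i | j) <;> simp [hcon]
    rw [hEeq, Finset.sum_map] at hE0
    simp only [hg, Function.Embedding.inl_apply, Sum.elim_inl] at hE0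
    refine hnz C hC h0 E.toLeft ?_ hE0
    rw [hEeq] at hEne
    exact Finset.map_nonempty.1 hEne
  · rw [← hγrank]
    refine gateRank_le_rankBoundML γ E ?_ ?_ ?_ ?_
    · refine (Finset.card_le_univ E).trans ?_
      rw [Fintype.card_sum]
      omega
    · rintro (i | j) -
      · exact hCm i
      · rw [hγg]
        exact neg_mem (hDm j)
    · simpa only [hγg] using hE0
    · simpa only [hγg] using hEmin

end Clustering

/-! ### Matching the clusters of two circuits -/

section Matching

/-- `B` is covered by the pieces through its elements; each meets `A`, so adjoining it costs at most
`R`. -/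
lemma gateRank_le_of_pieces {F : Type*} [Field F] {n : ℕ} {κ : Type*} [DecidableEq κ]
    (γ : κ → MulGate F n) {R : ℕ} {S : Finset κ} (Z : Finpartition S)
    (hZ : ∀ E ∈ Z.parts, gateRank γ (E : Set κ) ≤ R) (A B : Finset κ) (hB : B ⊆ S)
    (hAB : ∀ x ∈ B, (Z.part x ∩ A).Nonempty) :
    gateRank γ (B : Set κ) ≤ gateRank γ (A : Set κ) + B.card * R := by
  refine le_trans (gateRank_mono γ (Finset.finite_toSet _) ?_) (gateRank_union_biUnion_le γ A
    Z.part B (fun x hx => hZ _ (Z.part_mem.2 (hB hx))) hAB)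
  intro x hx
  exact Finset.mem_union_right _ (Finset.mem_biUnion.2 ⟨x, hx, Z.mem_part_self.2 (hB hx)⟩)

variable {F : Type u} [Field F] {n : ℕ} {ι κ : Type} [Fintype ι] [DecidableEq ι] [Fintype κ]
  [DecidableEq κ]

/-- The clusters of two circuits correspond to each other: they compute the same polynomials and
their syntactic ranks are close. -/
def ClusterMatch (e : ℕ) (C : Circuit F n ι) (P : Finpartition (Finset.univ : Finset ι))
    (D : Circuit F n κ) (Q : Finpartition (Finset.univ : Finset κ)) : Prop :=
  ∃ π : P.parts ≃ Q.parts, ∀ A : P.parts, (C.sub A.1).poly = (D.sub (π A).1).poly ∧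
    (D.sub (π A).1).synRank ≤ (C.sub A.1).synRank + e ∧
    (C.sub A.1).synRank ≤ (D.sub (π A).1).synRank + e

lemma ClusterMatch.symm {e : ℕ} {C : Circuit F n ι} {P : Finpartition (Finset.univ : Finset ι)}
    {D : Circuit F n κ} {Q : Finpartition (Finset.univ : Finset κ)}
    (h : ClusterMatch e C P D Q) : ClusterMatch e D Q C P := by
  obtain ⟨π, hπ⟩ := h
  refine ⟨π.symm, fun B => ?_⟩
  obtain ⟨h1, h2, h3⟩ := hπ (π.symm B)
  rw [Equiv.apply_symm_apply] at h1 h2 h3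
  exact ⟨h1.symm, h3, h2⟩

/-- A clustering whose clusters are far apart, compared to the ranks in another clustering of a
circuit for the same polynomial, is coarser than the latter. -/
lemma card_le_and_clusterMatch {C : Circuit F n ι} {D : Circuit F n κ} {k r r' : ℕ}
    (hι : Fintype.card ι ≤ k) (hκ : Fintype.card κ ≤ k)
    (hCm : C.IsMultilinear) (hDm : D.IsMultilinear) (hC : C.IsMinimal) (hD : D.IsMinimal)
    (hCD : C.poly = D.poly) (h0 : C.poly ≠ 0)
    (P : Finpartition (Finset.univ : Finset ι)) (Q : Finpartition (Finset.univ : Finset κ))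
    (hP : ∀ A ∈ P.parts, gateRank C (A : Set ι) ≤ r)
    (hQ : ∀ B ∈ Q.parts, gateRank D (B : Set κ) ≤ r')
    (hsep : ∀ B ∈ Q.parts, ∀ B' ∈ Q.parts, B ≠ B' →
      2 * r' + (2 * rankBoundML.{u} (2 * k) + r) < gateRank D ((B : Set κ) ∪ B')) :
    Q.parts.card ≤ P.parts.card ∧
      (P.parts.card = Q.parts.card → ClusterMatch (k * rankBoundML.{u} (2 * k)) C P D Q) := by
  obtain ⟨Z, hZ⟩ := exists_common_pieces hι hκ hCm hDm hC hD hCD h0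
  set R := rankBoundML.{u} (2 * k) with hR
  have hCrank : ∀ A : Finset ι, gateRank C (A : Set ι) =
      gateRank (C.add D) ((A.map Function.Embedding.inl : Finset (ι ⊕ κ)) : Set (ι ⊕ κ)) := by
    intro A
    rw [Finset.coe_map, gateRank_image]
    rfl
  have hDrank : ∀ B : Finset κ, gateRank D (B : Set κ) =
      gateRank (C.add D) ((B.map Function.Embedding.inr : Finset (ι ⊕ κ)) : Set (ι ⊕ κ)) := by
    intro B
    rw [Finset.coe_map, gateRank_image]
    rfl
  -- A set of rank at most `2 * R + r` linking two clusters of `D` would bring them closer than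
  -- `hsep` allows.
  have hmerge : ∀ (X : Finset (ι ⊕ κ)) (j j' : κ), Sum.inr j ∈ X → Sum.inr j' ∈ X →
      gateRank (C.add D) (X : Set (ι ⊕ κ)) ≤ 2 * R + r → Q.part j = Q.part j' := by
    intro X j j' hj hj' hX
    by_contra hne
    have hB : Q.part j ∈ Q.parts := Q.part_mem.2 (Finset.mem_univ j)
    have hB' : Q.part j' ∈ Q.parts := Q.part_mem.2 (Finset.mem_univ j')
    have hjB : j ∈ Q.part j := Q.mem_part_self.2 (Finset.mem_univ j)
    have hjB' : j' ∈ Q.part j' := Q.mem_part_self.2 (Finset.mem_univ j')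
    have h1 := hsep _ hB _ hB' hne
    have h2 := hQ _ hB
    have h3 := hQ _ hB'
    rw [← Finset.coe_union, hDrank] at h1
    rw [hDrank] at h2 h3
    have h4 := gateRank_union_le (C.add D)
      ((Q.part j).map Function.Embedding.inr : Finset (ι ⊕ κ)).finite_toSet X.finite_toSet
      ⟨Sum.inr j, Finset.mem_coe.2 (Finset.mem_map_of_mem _ hjB), hj⟩
    rw [← Finset.coe_union] at h4
    have h5 := gateRank_union_le (C.add D)
      ((Q.part j).map Function.Embedding.inr ∪ X : Finset (ι ⊕ κ)).finite_toSet
      ((Q.part j').map Function.Embedding.inr : Finset (ι ⊕ κ)).finite_toSet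
      ⟨Sum.inr j', Finset.mem_coe.2 (Finset.mem_union_right _ hj'),
        Finset.mem_coe.2 (Finset.mem_map_of_mem _ hjB')⟩
    rw [← Finset.coe_union] at h5
    have h6 := gateRank_mono (C.add D)
      (S := (((Q.part j ∪ Q.part j').map Function.Embedding.inr : Finset (ι ⊕ κ)) : Set (ι ⊕ κ)))
      (T := (((Q.part j).map Function.Embedding.inr ∪ X ∪
        (Q.part j').map Function.Embedding.inr : Finset (ι ⊕ κ)) : Set (ι ⊕ κ)))
      (Finset.finite_toSet _) (by
        rw [Finset.map_union, Finset.coe_subset]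
        refine Finset.union_subset ?_ Finset.subset_union_right
        exact Finset.subset_union_left.trans Finset.subset_union_left)
    omega
  -- Any two pieces meeting `A` form together with `A` a set of rank at most `2 * R + r`, so they
  -- reach the same cluster of `D`.
  have hπ : ∀ A : P.parts, ∃ B : Q.parts, ∀ E ∈ Z.parts, ∀ i j, i ∈ A.1 → Sum.inl i ∈ E →
      Sum.inr j ∈ E → Q.part j = B.1 := by
    rintro ⟨A, hA⟩
    obtain ⟨i₀, hi₀⟩ := P.nonempty_of_mem_parts hA
    have hE₀ : Z.part (Sum.inl i₀) ∈ Z.parts := Z.part_mem.2 (Finset.mem_univ _)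
    obtain ⟨-, ⟨j₀, hj₀⟩, -, hrank₀⟩ := hZ _ hE₀
    refine ⟨⟨Q.part j₀, Q.part_mem.2 (Finset.mem_univ _)⟩, fun E hE i j hi hiE hjE => ?_⟩
    obtain ⟨-, -, -, hrank⟩ := hZ E hE
    have h1 := hP A hA
    rw [hCrank] at h1
    have h2 := gateRank_union_le (C.add D) E.finite_toSet
      (A.map Function.Embedding.inl : Finset (ι ⊕ κ)).finite_toSet
      ⟨Sum.inl i, hiE, Finset.mem_coe.2 (Finset.mem_map_of_mem _ hi)⟩
    rw [← Finset.coe_union] at h2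
    have h3 := gateRank_union_le (C.add D)
      (E ∪ A.map Function.Embedding.inl : Finset (ι ⊕ κ)).finite_toSet
      (Z.part (Sum.inl i₀)).finite_toSet
      ⟨Sum.inl i₀, Finset.mem_coe.2
        (Finset.mem_union_right _ (Finset.mem_map_of_mem _ hi₀)),
        Z.mem_part_self.2 (Finset.mem_univ _)⟩
    rw [← Finset.coe_union] at h3
    exact hmerge (E ∪ A.map Function.Embedding.inl ∪ Z.part (Sum.inl i₀)) j j₀ (Finset.mem_union_left _ (Finset.mem_union_left _ hjE))
      (Finset.mem_union_right _ hj₀) (by omega)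
  choose π hπ using hπ
  have hPmem : ∀ i, P.part i ∈ P.parts := fun i => P.part_mem.2 (Finset.mem_univ i)
  have hiP : ∀ i, i ∈ P.part i := fun i => P.mem_part_self.2 (Finset.mem_univ i)
  have hQmem : ∀ j, Q.part j ∈ Q.parts := fun j => Q.part_mem.2 (Finset.mem_univ j)
  -- Every gate is labelled by a cluster of `D`: its own, or the image of its cluster in `C`. The
  -- label is constant on pieces.
  set h : ι ⊕ κ → Q.parts := Sum.elim (fun i => π ⟨P.part i, hPmem i⟩)
    fun j => ⟨Q.part j, hQmem j⟩ with hh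
  have hlr : ∀ E ∈ Z.parts, ∀ i j, Sum.inl i ∈ E → Sum.inr j ∈ E →
      π ⟨P.part i, hPmem i⟩ = ⟨Q.part j, hQmem j⟩ := fun E hE i j hi hj =>
    Subtype.ext (hπ ⟨P.part i, hPmem i⟩ E hE i j (hiP i) hi hj).symm
  have hconst : ∀ E ∈ Z.parts, ∀ x ∈ E, ∀ y ∈ E, h x = h y := by
    intro E hE
    obtain ⟨⟨i₀, hi₀⟩, ⟨j₀, hj₀⟩, -, -⟩ := hZ E hE
    have : ∀ x ∈ E, h x = ⟨Q.part j₀, hQmem j₀⟩ := by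
      rintro (i | j) hx
      · exact hlr E hE i j₀ hx hj₀
      · exact (hlr E hE i₀ j hi₀ hx).symm.trans (hlr E hE i₀ j₀ hi₀ hj₀)
    intro x hx y hy
    rw [this x hx, this y hy]
  have hsurj : Function.Surjective π := by
    rintro ⟨B, hB⟩
    obtain ⟨j, hj⟩ := Q.nonempty_of_mem_parts hB
    have hE : Z.part (Sum.inr j) ∈ Z.parts := Z.part_mem.2 (Finset.mem_univ _)
    obtain ⟨⟨i, hi⟩, -, -, -⟩ := hZ _ hE
    refine ⟨⟨P.part i, hPmem i⟩, (hlr _ hE i j hi (Z.mem_part_self.2 (Finset.mem_univ _))).trans ?_⟩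
    exact Subtype.ext (Q.part_eq_of_mem hB hj)
  refine ⟨by simpa using Fintype.card_le_of_surjective π hsurj, fun hcard => ?_⟩
  have hbij : Function.Bijective π :=
    (Fintype.bijective_iff_surjective_and_card π).2 ⟨hsurj, by simpa using hcard⟩
  refine ⟨Equiv.ofBijective π hbij, fun A => ?_⟩
  have hπA : (Equiv.ofBijective π hbij) A = π A := rfl
  have hiA : ∀ i, π ⟨P.part i, hPmem i⟩ = π A ↔ i ∈ A.1 := by
    intro i
    rw [hbij.1.eq_iff, Subtype.ext_iff]
    exact P.part_eq_iff_mem A.2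
  have hjB : ∀ j, (⟨Q.part j, hQmem j⟩ : Q.parts) = π A ↔ j ∈ (π A).1 := by
    intro j
    rw [Subtype.ext_iff]
    exact Q.part_eq_iff_mem (π A).2
  have hcardle : ∀ S : Finset ι, S.card * R ≤ k * R := fun S =>
    Nat.mul_le_mul_right _ ((Finset.card_le_univ S).trans hι)
  have hcardle' : ∀ S : Finset κ, S.card * R ≤ k * R := fun S =>
    Nat.mul_le_mul_right _ ((Finset.card_le_univ S).trans hκ)
  rw [hπA, Circuit.poly_sub, Circuit.poly_sub, Circuit.synRank_sub, Circuit.synRank_sub,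
    hCrank, hDrank]
  refine ⟨?_, ?_, ?_⟩
  -- For bijective `π` the gates labelled `π A` are exactly those of `A` and of `π A`, and they form
  -- a union of vanishing pieces.
  · have hsum := sum_filter_eq_zero_of_finpartition
      (Sum.elim (fun i => (C i).poly) (fun j => -(D j).poly)) Z (fun E hE => (hZ E hE).2.2.1) h
      hconst (π A)
    rw [Finset.sum_filter, Fintype.sum_sum_type] at hsum
    simp only [hh, Sum.elim_inl, Sum.elim_inr, hiA, hjB] at hsum
    rw [← Finset.sum_filter, ← Finset.sum_filter, Finset.filter_mem_eq_inter,
      Finset.filter_mem_eq_inter, Finset.univ_inter, Finset.univ_inter,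
      Finset.sum_neg_distrib] at hsum
    exact add_neg_eq_zero.1 hsum
  · refine (gateRank_le_of_pieces (C.add D) Z (fun E hE => (hZ E hE).2.2.2)
      (A.1.map Function.Embedding.inl) ((π A).1.map Function.Embedding.inr)
      (Finset.subset_univ _) fun x hx => ?_).trans ?_
    · obtain ⟨j, hj, rfl⟩ := Finset.mem_map.1 hx
      have hE : Z.part (Sum.inr j) ∈ Z.parts := Z.part_mem.2 (Finset.mem_univ _)
      obtain ⟨⟨i, hi⟩, -, -, -⟩ := hZ _ hE
      refine ⟨Sum.inl i, Finset.mem_inter.2 ⟨hi, Finset.mem_map_of_mem _ ((hiA i).1 ?_)⟩⟩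
      rw [hlr _ hE i j hi (Z.mem_part_self.2 (Finset.mem_univ _))]
      exact (hjB j).2 hj
    · rw [Finset.card_map]
      exact Nat.add_le_add_left (hcardle' _) _
  · refine (gateRank_le_of_pieces (C.add D) Z (fun E hE => (hZ E hE).2.2.2)
      ((π A).1.map Function.Embedding.inr) (A.1.map Function.Embedding.inl)
      (Finset.subset_univ _) fun x hx => ?_).trans ?_
    · obtain ⟨i, hi, rfl⟩ := Finset.mem_map.1 hx
      have hE : Z.part (Sum.inl i) ∈ Z.parts := Z.part_mem.2 (Finset.mem_univ _)
      obtain ⟨-, ⟨j, hj⟩, -, -⟩ := hZ _ hE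
      refine ⟨Sum.inr j, Finset.mem_inter.2 ⟨hj, Finset.mem_map_of_mem _ ((hjB j).1 ?_)⟩⟩
      rw [← hlr _ hE i j (Z.mem_part_self.2 (Finset.mem_univ _)) hj]
      exact (hiA i).2 hi
    · rw [Finset.card_map]
      exact Nat.add_le_add_left (hcardle _) _

end Matching

/-! ### Choice of τ -/

section Parameters

/-- If the ranges of a multivalued function decrease, then one of its first `k` ranges has at most
one element. -/
lemma exists_subsingleton_of_antitone (N : ℕ → Set ℕ) {k : ℕ} (hk : 1 ≤ k)
    (hN : ∀ j, ∀ s ∈ N j, 1 ≤ s ∧ s ≤ k) (hanti : ∀ j, ∀ s ∈ N (j + 1), ∀ s' ∈ N j, s ≤ s') :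
    ∃ j < k, ∀ s ∈ N j, ∀ s' ∈ N j, s = s' := by
  by_contra! hcon
  have hlt : ∀ j < k, ∃ a ∈ N j, ∃ b ∈ N j, a < b := by
    intro j hj
    obtain ⟨a, ha, b, hb, hab⟩ := hcon j hj
    rcases lt_or_gt_of_ne hab with h | h
    · exact ⟨a, ha, b, hb, h⟩
    · exact ⟨b, hb, a, ha, h⟩
  -- If every range had two elements, its smaller one would drop by at least one per step and fall
  -- below `1` at `j = k - 1`.
  have key : ∀ j < k, ∃ a ∈ N j, a + j + 1 ≤ k := by
    intro j
    induction j with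
    | zero =>
      intro hj
      obtain ⟨a, ha, b, hb, hab⟩ := hlt 0 hj
      exact ⟨a, ha, by have := (hN 0 b hb).2; omega⟩
    | succ j ih =>
      intro hj
      obtain ⟨a, ha, hak⟩ := ih (by omega)
      obtain ⟨a', ha', b', hb', hab'⟩ := hlt (j + 1) hj
      exact ⟨a', ha', by have := hanti j b' hb' a ha; omega⟩
  obtain ⟨a, ha, hak⟩ := key (k - 1) (by omega)
  have := (hN _ a ha).1
  omega

/-- A rapidly growing sequence of candidates for the parameter `τ`. -/
def tauSeq (k j : ℕ) : ℕ := (8 * k) ^ (k ^ (2 * j))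

lemma eight_le_tauSeq {k : ℕ} (hk : 1 ≤ k) (j : ℕ) : 8 ≤ tauSeq k j :=
  calc 8 ≤ 8 * k := by omega
    _ = (8 * k) ^ 1 := (pow_one _).symm
    _ ≤ tauSeq k j := Nat.pow_le_pow_right (by omega) (Nat.pow_pos hk)

/-- The power bounds `r / R` in a clustering with parameter `tauSeq k j`. The extra `5` absorbs `2 *
r' + 2 * R` with strict inequality when `1 ≤ R ≤ r'`. -/
lemma tauSeq_succ_ge {k : ℕ} (hk : 2 ≤ k) (j : ℕ) :
    (k * tauSeq k j) ^ (k - 1) + 5 ≤ tauSeq k (j + 1) := by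
  set e := k ^ (2 * j) with he
  have he1 : 1 ≤ e := Nat.pow_pos (by omega)
  have h1 : k * tauSeq k j ≤ (8 * k) ^ (e + 1) := by
    rw [pow_succ', tauSeq]
    exact Nat.mul_le_mul_right _ (by omega)
  have hpos : 1 ≤ (8 * k) ^ (e + 1) := Nat.pow_pos (by omega)
  have h8 : 8 ≤ (8 * k) ^ (e + 1) :=
    calc 8 ≤ 8 * k := by omega
      _ = (8 * k) ^ 1 := (pow_one _).symm
      _ ≤ _ := Nat.pow_le_pow_right (by omega) (by omega)
  have h2 : (k * tauSeq k j) ^ (k - 1) ≤ ((8 * k) ^ (e + 1)) ^ (k - 1) :=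
    Nat.pow_le_pow_left h1 _
  have h3 : 1 ≤ ((8 * k) ^ (e + 1)) ^ (k - 1) := Nat.pow_pos hpos
  have h4 : ((8 * k) ^ (e + 1)) ^ k = ((8 * k) ^ (e + 1)) ^ (k - 1) * (8 * k) ^ (e + 1) := by
    rw [← pow_succ, Nat.sub_add_cancel (by omega)]
  -- One factor `k` of the new exponent comes from the outer power, the other from `e + 1 ≤ e * k`.
  have h5 : (e + 1) * k ≤ k ^ (2 * (j + 1)) := by
    have : k ^ (2 * (j + 1)) = e * k * k := by rw [he]; ring
    rw [this]
    exact Nat.mul_le_mul_right _ (by nlinarith)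
  have h6 : ((8 * k) ^ (e + 1)) ^ k ≤ tauSeq k (j + 1) := by
    rw [← pow_mul]
    exact Nat.pow_le_pow_right (by omega) h5
  nlinarith

lemma tauSeq_le {k j : ℕ} (hk : 1 ≤ k) (hj : j < k) :
    tauSeq k j ≤ (8 * k ^ (k + 2)) ^ (k ^ (2 * k + 1)) :=
  calc tauSeq k j ≤ (8 * k ^ (k + 2)) ^ (k ^ (2 * j)) :=
        Nat.pow_le_pow_left (Nat.mul_le_mul_left _ (Nat.le_self_pow (by omega) k)) _
    _ ≤ _ := Nat.pow_le_pow_right (Nat.mul_pos (by norm_num) (Nat.pow_pos hk))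
        (Nat.pow_le_pow_right hk (by omega))

end Parameters

/-! ### Single clusters and the zero polynomial -/

section Degenerate

variable {F : Type u} [Field F] {n : ℕ} {ι κ : Type} [Fintype ι] [DecidableEq ι] [Fintype κ]
  [DecidableEq κ]

lemma eq_univ_of_mem_parts_of_card_eq_one {P : Finpartition (Finset.univ : Finset ι)}
    (hP : P.parts.card = 1) {A : Finset ι} (hA : A ∈ P.parts) : A = Finset.univ := by
  obtain ⟨X, hX⟩ := Finset.card_eq_one.1 hP
  have h1 := P.biUnion_parts
  rw [hX, Finset.singleton_biUnion, id] at h1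
  rw [hX, Finset.mem_singleton] at hA
  rw [hA, h1]

lemma clusterMatch_of_card_one {C : Circuit F n ι} {D : Circuit F n κ} {e : ℕ}
    {P : Finpartition (Finset.univ : Finset ι)} {Q : Finpartition (Finset.univ : Finset κ)}
    (hCD : C.poly = D.poly) (hP : P.parts.card = 1) (hQ : Q.parts.card = 1)
    (hC : gateRank C Set.univ ≤ e) (hD : gateRank D Set.univ ≤ e) : ClusterMatch e C P D Q := by
  refine ⟨Finset.equivOfCardEq (hP.trans hQ.symm), fun A => ?_⟩
  rw [eq_univ_of_mem_parts_of_card_eq_one hP A.2,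
    eq_univ_of_mem_parts_of_card_eq_one hQ (Subtype.property _), Circuit.poly_sub, Circuit.poly_sub, Circuit.synRank_sub, Circuit.synRank_sub,
    Finset.coe_univ, Finset.coe_univ]
  exact ⟨hCD, hD.trans (Nat.le_add_left _ _), hC.trans (Nat.le_add_left _ _)⟩

lemma parts_card_pos [Nonempty ι] (P : Finpartition (Finset.univ : Finset ι)) :
    1 ≤ P.parts.card :=
  Finset.card_pos.2 (P.parts_nonempty (Finset.nonempty_iff_ne_empty.1 Finset.univ_nonempty))

/-- A minimal circuit for the zero polynomial has a single cluster. -/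
lemma card_parts_eq_one_of_poly_eq_zero {C : Circuit F n ι} [Nonempty ι] {k τ : ℕ} (hk : 2 ≤ k)
    (hι : Fintype.card ι ≤ k) (hm : C.IsMultilinear) (hC : C.IsMinimal) (h0 : C.poly = 0)
    (hτ : 2 ≤ τ) {P : Finpartition (Finset.univ : Finset ι)} (hP : IsClusteringOutput k τ C P) :
    P.parts.card = 1 ∧ gateRank C Set.univ ≤ rankBoundML.{u} (2 * k) := by
  have hrank : gateRank C Set.univ ≤ rankBoundML.{u} (2 * k) := by
    have := gateRank_le_rankBoundML (k := 2 * k) C Finset.univ (by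
      rw [Finset.card_univ]; omega) (fun i _ => hm i) h0 (fun S _ => hC S)
    rwa [Finset.coe_univ] at this
  refine ⟨?_, hrank⟩
  have hR := one_le_rankBoundML F (k := 2 * k) (by omega)
  obtain ⟨r, hr, hr', -⟩ := hP
  rw [Circuit.isSynPartition_iff] at hr'
  by_contra hne
  have h1 := parts_card_pos P
  -- Two clusters would have distance at least `2 * r ≥ 2 * R > R`, although the whole circuit has
  -- rank at most `R`.
  obtain ⟨A, hA, B, hB, hAB⟩ := Finset.one_lt_card.1 (show 1 < P.parts.card by omega)
  have h2 := hr'.2 A hA B hB hAB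
  have h3 := gateRank_mono C (S := (A : Set ι) ∪ B) Set.finite_univ (Set.subset_univ _)
  have h4 : 2 * r ≤ τ * r := Nat.mul_le_mul_right _ hτ
  omega

end Degenerate

/-! ### Counting clusters and conclusion -/

section Main

variable {F : Type u} [Field F] {n : ℕ}

/-- The numbers of clusters in the possible clusterings, with parameter `τ`, of the minimal
multilinear circuits for `f`. -/
def clusterCounts (k τ : ℕ) (f : MvPolynomial (Fin n) F) : Set ℕ :=
  {s | ∃ (m : ℕ) (C : Circuit F n (Fin m)) (P : Finpartition (Finset.univ : Finset (Fin m))),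
    1 ≤ m ∧ m ≤ k ∧ C.IsMultilinear ∧ C.IsMinimal ∧ C.poly = f ∧
      IsClusteringOutput k τ C P ∧ P.parts.card = s}

/-- For some parameter `τ`, all clusterings of minimal multilinear circuits for a non-zero
polynomial have the same number of clusters. -/
lemma exists_clusterCounts_subsingleton {k : ℕ} (hk : 2 ≤ k) {f : MvPolynomial (Fin n) F}
    (hf : f ≠ 0) : ∃ j < k, ∀ s ∈ clusterCounts k (tauSeq k j) f,
      ∀ s' ∈ clusterCounts k (tauSeq k j) f, s = s' := by
  have hR := one_le_rankBoundML F (k := 2 * k) (by omega)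
  refine exists_subsingleton_of_antitone (fun j => clusterCounts k (tauSeq k j) f) (by omega) ?_ ?_
  · rintro j s ⟨m, C, P, hm, hmk, -, -, -, -, rfl⟩
    have : NeZero m := ⟨by omega⟩
    exact ⟨parts_card_pos P, P.card_parts_le_card.trans (by simpa using hmk)⟩
  · rintro j s ⟨m', D, Q, hm', hmk', hDm, hD, hDf, hQ, rfl⟩ s' ⟨m, C, P, hm, hmk, hCm, hC, hCf, hP, rfl⟩
    have : NeZero m := ⟨by omega⟩
    have h8 := eight_le_tauSeq (k := k) (by omega) j
    obtain ⟨r, hr, hrle, hPr⟩ := hP.exists_isSynPartition (by simpa using hmk) (by omega)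
    obtain ⟨r', hr', hQr, -⟩ := hQ
    rw [Circuit.isSynPartition_iff] at hPr hQr
    refine (card_le_and_clusterMatch (k := k) (r := r) (r' := r') (by simpa using hmk)
      (by simpa using hmk') hCm hDm hC hD (hCf.trans hDf.symm) (hCf ▸ hf) P Q hPr.1 hQr.1 ?_).1
    intro B hB B' hB' hne
    refine lt_of_lt_of_le ?_ (hQr.2 B hB B' hB' hne)
    have h1 := Nat.mul_le_mul_right r' (tauSeq_succ_ge hk j)
    have h2 : (k * tauSeq k j) ^ (k - 1) * rankBoundML.{u} (2 * k) ≤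
      (k * tauSeq k j) ^ (k - 1) * r' := Nat.mul_le_mul_left _ hr'
    rw [add_mul] at h1
    omega

lemma clusterMatch_of_card_eq {k τ m m' : ℕ} (hk : 2 ≤ k) (hτ : 6 ≤ τ)
    {C : Circuit F n (Fin m)} {D : Circuit F n (Fin m')} (hmk : m ≤ k) (hmk' : m' ≤ k)
    (hCm : C.IsMultilinear) (hDm : D.IsMultilinear) (hC : C.IsMinimal) (hD : D.IsMinimal)
    (hCD : C.poly = D.poly) (h0 : C.poly ≠ 0)
    {P : Finpartition (Finset.univ : Finset (Fin m))}
    {Q : Finpartition (Finset.univ : Finset (Fin m'))}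
    (hP : IsClusteringOutput k τ C P) (hQ : IsClusteringOutput k τ D Q)
    (hcard : P.parts.card = Q.parts.card) :
    ClusterMatch (k * rankBoundML.{u} (2 * k)) C P D Q := by
  have hR := one_le_rankBoundML F (k := 2 * k) (by omega)
  obtain ⟨r, hr, hPr, -⟩ := hP
  obtain ⟨r', hr', hQr, -⟩ := hQ
  rw [Circuit.isSynPartition_iff] at hPr hQr
  have hι : Fintype.card (Fin m) ≤ k := by simpa using hmk
  have hκ : Fintype.card (Fin m') ≤ k := by simpa using hmk'
  -- The surjection goes towards the clustering with the larger parameter, whose distances are at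
  -- least six times that parameter.
  rcases le_total r r' with hrr | hrr
  · refine (card_le_and_clusterMatch (r := r) (r' := r') hι hκ hCm hDm hC hD hCD h0 P Q hPr.1
      hQr.1 ?_).2 hcard
    intro B hB B' hB' hne
    refine lt_of_lt_of_le ?_ (hQr.2 B hB B' hB' hne)
    have := Nat.mul_le_mul_right r' hτ
    omega
  · refine ((card_le_and_clusterMatch (r := r') (r' := r) hκ hι hDm hCm hD hC hCD.symm
      (hCD ▸ h0) Q P hQr.1 hPr.1 ?_).2 hcard.symm).symm
    intro B hB B' hB' hne
    refine lt_of_lt_of_le ?_ (hPr.2 B hB B' hB' hne)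
    have := Nat.mul_le_mul_right r hτ
    omega

end Main

end DepthThree

theorem mainTheorem4 :
    ∃ c : ℕ, ∀ (F : Type u) [Field F] (n k : ℕ) (f : MvPolynomial (Fin n) F),
      DepthThree.MemSPS k f →
      ∃ τ : ℕ, τ ≤ (c * k ^ (k + 2)) ^ (k ^ (2 * k + 1)) ∧
        ∀ (m m' : ℕ) (C : DepthThree.Circuit F n (Fin m)) (D : DepthThree.Circuit F n (Fin m')),
          1 ≤ m → m ≤ k → C.IsMultilinear → C.IsMinimal → C.poly = f →
          1 ≤ m' → m' ≤ k → D.IsMultilinear → D.IsMinimal → D.poly = f →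
          ∀ (P : Finpartition (Finset.univ : Finset (Fin m)))
            (Q : Finpartition (Finset.univ : Finset (Fin m'))),
            DepthThree.IsClusteringOutput k τ C P →
            DepthThree.IsClusteringOutput k τ D Q →
            P.parts.card = Q.parts.card ∧
            ∃ π : P.parts ≃ Q.parts, ∀ A : P.parts,
              (C.sub A.1).poly = (D.sub (π A).1).poly ∧
              ((C.sub A.1).synRank : ℝ) / k - 2 * DepthThree.rankBoundML.{u} (2 * k)
                ≤ (D.sub (π A).1).synRank ∧
              ((D.sub (π A).1).synRank : ℝ)
                ≤ k * (C.sub A.1).synRank + 2 * k * DepthThree.rankBoundML.{u} (2 * k) := by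
  refine ⟨8, fun F _ n k f hf => ?_⟩
  obtain ⟨m₀, -, hm₀, hm₀k, -, -⟩ := hf
  -- The argument yields the additive error `k * R`, which implies the stated bounds because `k ≥
  -- 1`.
  suffices h : ∃ τ : ℕ, τ ≤ (8 * k ^ (k + 2)) ^ (k ^ (2 * k + 1)) ∧
      ∀ (m m' : ℕ) (C : DepthThree.Circuit F n (Fin m)) (D : DepthThree.Circuit F n (Fin m')),
        1 ≤ m → m ≤ k → C.IsMultilinear → C.IsMinimal → C.poly = f →
        1 ≤ m' → m' ≤ k → D.IsMultilinear → D.IsMinimal → D.poly = f →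
        ∀ (P : Finpartition (Finset.univ : Finset (Fin m)))
          (Q : Finpartition (Finset.univ : Finset (Fin m'))),
          DepthThree.IsClusteringOutput k τ C P → DepthThree.IsClusteringOutput k τ D Q →
          DepthThree.ClusterMatch (k * DepthThree.rankBoundML.{u} (2 * k)) C P D Q by
    obtain ⟨τ, hτ, h⟩ := h
    refine ⟨τ, hτ, fun m m' C D hm hmk hCm hC hCf hm' hmk' hDm hD hDf P Q hP hQ => ?_⟩
    obtain ⟨π, hπ⟩ := h m m' C D hm hmk hCm hC hCf hm' hmk' hDm hD hDf P Q hP hQ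
    refine ⟨by simpa using Fintype.card_congr π, π, fun A => ?_⟩
    obtain ⟨h1, h2, h3⟩ := hπ A
    have hk : (1 : ℝ) ≤ k := by exact_mod_cast hm.trans hmk
    have h2' : ((D.sub (π A).1).synRank : ℝ) ≤
        (C.sub A.1).synRank + k * DepthThree.rankBoundML.{u} (2 * k) := by exact_mod_cast h2
    have h3' : ((C.sub A.1).synRank : ℝ) ≤
        (D.sub (π A).1).synRank + k * DepthThree.rankBoundML.{u} (2 * k) := by exact_mod_cast h3
    have hD0 : (0 : ℝ) ≤ (D.sub (π A).1).synRank := Nat.cast_nonneg _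
    have hC0 : (0 : ℝ) ≤ (C.sub A.1).synRank := Nat.cast_nonneg _
    have hR0 : (0 : ℝ) ≤ k * DepthThree.rankBoundML.{u} (2 * k) := by positivity
    refine ⟨h1, ?_, ?_⟩
    · rw [sub_le_iff_le_add, div_le_iff₀ (by linarith)]
      have := mul_le_mul_of_nonneg_left hk hD0
      linarith
    · have := mul_le_mul_of_nonneg_right hk hC0
      linarith
  rcases Nat.lt_or_ge k 2 with hk | hk
  -- Both circuits consist of a single gate, of rank zero, so any `τ` will do.
  · refine ⟨0, Nat.zero_le _, fun m m' C D hm hmk _ _ hCf hm' hmk' _ _ hDf P Q _ _ => ?_⟩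
    obtain rfl : m = 1 := by omega
    obtain rfl : m' = 1 := by omega
    refine DepthThree.clusterMatch_of_card_one (hCf.trans hDf.symm) ?_ ?_ ?_ ?_
    · exact le_antisymm (P.card_parts_le_card.trans (by simp)) (DepthThree.parts_card_pos P)
    · exact le_antisymm (Q.card_parts_le_card.trans (by simp)) (DepthThree.parts_card_pos Q)
    · rw [DepthThree.gateRank_of_subsingleton C Set.subsingleton_univ]
      exact Nat.zero_le _
    · rw [DepthThree.gateRank_of_subsingleton D Set.subsingleton_univ]
      exact Nat.zero_le _
  -- The zero polynomial is treated apart because its pieces need not contain gates of both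
  -- circuits.
  by_cases hf : f = 0
  · refine ⟨DepthThree.tauSeq k 0, DepthThree.tauSeq_le (by omega) (by omega),
      fun m m' C D hm hmk hCm hC hCf hm' hmk' hDm hD hDf P Q hP hQ => ?_⟩
    have : NeZero m := ⟨by omega⟩
    have : NeZero m' := ⟨by omega⟩
    have hτ := DepthThree.eight_le_tauSeq (k := k) (by omega) 0
    obtain ⟨hP1, hCr⟩ := DepthThree.card_parts_eq_one_of_poly_eq_zero hk (by simpa using hmk) hCm
      hC (hCf.trans hf) (by omega) hP
    obtain ⟨hQ1, hDr⟩ := DepthThree.card_parts_eq_one_of_poly_eq_zero hk (by simpa using hmk') hDm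
      hD (hDf.trans hf) (by omega) hQ
    have hle := Nat.le_mul_of_pos_left (DepthThree.rankBoundML.{u} (2 * k)) (show 0 < k by omega)
    exact DepthThree.clusterMatch_of_card_one (hCf.trans hDf.symm) hP1 hQ1 (hCr.trans hle)
      (hDr.trans hle)
  · obtain ⟨j, hj, hjs⟩ := DepthThree.exists_clusterCounts_subsingleton hk hf
    have hτ := DepthThree.eight_le_tauSeq (k := k) (by omega) j
    refine ⟨DepthThree.tauSeq k j, DepthThree.tauSeq_le (by omega) hj,
      fun m m' C D hm hmk hCm hC hCf hm' hmk' hDm hD hDf P Q hP hQ => ?_⟩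
    exact DepthThree.clusterMatch_of_card_eq hk (by omega) hmk hmk' hCm hDm hC hD
      (hCf.trans hDf.symm) (hCf ▸ hf) hP hQ
      (hjs _ ⟨m, C, P, hm, hmk, hCm, hC, hCf, hP, rfl⟩ _ ⟨m', D, Q, hm', hmk', hDm, hD, hDf, hQ, rfl⟩)
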